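/- **Setting.** Let $V$ be a finite set of nodes with a (pseudo)metric $d$ (for instance the shortest-path distance of a weighted graph), let $p_v\in\mathbb Z_{\ge 0}$ be the number of food-insecure individuals at $v\in V$, let $N=\sum_v p_v$, and let $\mathcal F\subseteq V$ be a set of food banks. For each $v\in V$ let $f_v\in\mathcal F$ be a food bank closest to $v$ (equal distances are resolved by an arbitrary fixed rule), and let $N_f=\sum_{v:f_v=f}p_v$ be the number of individuals served by $f$. In each round $t=1,\dots,m$ a load $(x_t,y_t,w_t)\in V^2\times\mathbb R_{\ge 0}$ (origin, destination, value) arrives and is matched immediately and irrevocably to a food bank. Let $w_f(t)$ be the total value received by $f$ up to and including round $t$. *Two-choice algorithm.* Match the load $(x_t,y_t,w_t)$ to whichever $f\in\{f_{x_t},f_{y_t}\}$ has the smaller value per served individual $w_f(t-1)/N_f$. Equal values are resolved by an arbitrary fixed rule that depends only on $t$ and on the pair $(f_{x_t},f_{y_t})$. *Driver efficiency.* An algorithm is $\delta$-driver efficient if, for all sequences of loads, every load $(x,y,w)$ is matched to a food bank $f$ with $d(x,f)+d(f,y)\le\delta\min_{f'\in\mathcal F}\{d(x,f')+d(f',y)\}$.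 *Envy.* The outcome after $m$ rounds is $\gamma$-multiplicatively envy-free if $w_{f'}(m)/N_{f'}\le\gamma\, w_f(m)/N_f$ for all $f,f'\in\mathcal F$ with $N_f,N_{f'}>0$. *Stochastic model.* All origins, destinations and values are mutually independent; origins and destinations are drawn from a distribution $\mathcal D$ on $V$, and values from a distribution $\mathcal W$ on $\mathbb R_{\ge0}$. The distribution $\mathcal D$ is $(\alpha,\beta)$-biased if $$\frac{N_f}{\alpha N}\le\Pr_{v\sim\mathcal D}[f_v=f]\le\frac{\beta N_f}{N}\qquad\text{for all } f\in\mathcal F .$$ **Theorem.** The two-choice algorithm is $3$-driver efficient. Moreover, in the stochastic model: 1. *(Unit donations.)* Let $\alpha,\beta>1$ satisfy $2\ln\left(\frac{\alpha\beta-1}{\alpha\beta-\beta}\right)>\ln\left(\frac{\alpha\beta-1}{\alpha-1}\right)$, and let $k>0$. There is a constant $C>1$, depending only on $\alpha,\beta,k$, such that for every instance, every $(\alpha,\beta)$-biased $\mathcal D$ and every $m\ge C\,N\log N$: if all donations have value $1$, then with probability at least $1-N^{-k}$ the outcome after $m$ rounds is $(1+\varepsilon)$-multiplicatively envy-free with $$\varepsilon=C\cdot\frac{N\log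 N}{m-N\log N}.$$ 2. *(Random values.)* Let $1\le\alpha<\sqrt{5/4}$ and $1\le\beta<\sqrt{4/3}$, let $\mathcal W$ be a distribution on $\mathbb R_{\ge 0}$ with $\mathbb E[\mathcal W]=1$ and $\mathbb E[e^{\lambda\mathcal W}]<\infty$ for some $\lambda>0$, and let $k>0$. There is a constant $C>1$, depending only on $\alpha,\beta,\mathcal W,k$, such that for every instance, every $(\alpha,\beta)$-biased $\mathcal D$ and every $m\ge C$ with $m>N\sqrt m$: if the values are drawn from $\mathcal W$, then with probability at least $1-N^{-k}$ the outcome after $m$ rounds is $(1+\varepsilon)$-multiplicatively envy-free with $$\varepsilon=C\cdot\frac{N\log N}{m-N\sqrt m}.$$ -/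

import Mathlib

open scoped NNReal
open MeasureTheory

universe u

noncomputable section

namespace FoodRescue

/-- A food load `(x, y, w)`: origin of the driver, destination of the driver, and the (nonnegative)
value of the donation. -/
abbrev Load (V : Type u) : Type u := V × V × ℝ≥0

/-- An instance on a finite set `V` of nodes with distance `dist`: a set of nodes with a food bank,
the number of food-insecure individuals at every node, and, for every node, a food bank closest to
it (`nearest` is an arbitrary fixed way of resolving equal distances). -/
structure Network (V : Type u) [Fintype V] [PseudoMetricSpace V] where
  banks : Finset V
  pop : V → ℕ
  nearest : V → banks
  nearest_le : ∀ (v : V) (f : banks), dist v (nearest v : V) ≤ dist v (f : V)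

namespace Network

variable {V : Type u} [Fintype V] [PseudoMetricSpace V] (I : Network V)

/-- The total population `N`. -/
def total : ℕ := ∑ v, I.pop v

open Classical in
/-- The number `N_f` of individuals served by the food bank `f`. -/
def served (f : I.banks) : ℕ := ∑ v with I.nearest v = f, I.pop v

/-- The donations of the past rounds, each with the food bank it was matched to,
the most recent one first. -/
abbrev Transcript : Type u := List (Load V × I.banks)

/-- A matching algorithm irrevocably assigns the current load to a food bank, knowing the past
loads and their assignment. -/
abbrev Algorithm : Type u := I.Transcript → Load V → I.banks

/-- What has happened up to and including round `t`, when the loads arrive in the order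
`ω 0, ω 1, …`. -/
def transcript (A : I.Algorithm) (ω : ℕ → Load V) : ℕ → I.Transcript
  | 0 => []
  | t + 1 => (ω t, A (transcript A ω t) (ω t)) :: transcript A ω t

open Classical in
/-- The total value `w_f` received by the food bank `f` according to a transcript. -/
def received (h : I.Transcript) (f : I.banks) : ℝ :=
  (h.map fun e => if e.2 = f then (e.1.2.2 : ℝ) else 0).sum

/-- The value `w_f / N_f` received by each individual served by `f`. -/
def value (h : I.Transcript) (f : I.banks) : ℝ := I.received h f / I.served f

/-- The two-choice algorithm: of the food banks nearest to the origin and to the destination,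
take the one whose served individuals have received less value so far. If they have received the
same value, an arbitrary rule `tie` decides, depending on the round and on the two food banks. -/
def twoChoice (tie : ℕ → I.banks → I.banks → Bool) : I.Algorithm := fun h ℓ =>
  if I.value h (I.nearest ℓ.1) < I.value h (I.nearest ℓ.2.1) then I.nearest ℓ.1
  else if I.value h (I.nearest ℓ.2.1) < I.value h (I.nearest ℓ.1) then I.nearest ℓ.2.1
  else if tie h.length (I.nearest ℓ.1) (I.nearest ℓ.2.1) then I.nearest ℓ.1
  else I.nearest ℓ.2.1

/-- `δ`-driver efficiency: whatever loads arrive, no driver travels more than `δ` times the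
length of a shortest route from origin to destination through some food bank. -/
def DriverEfficient (δ : ℝ) (A : I.Algorithm) : Prop :=
  ∀ (ω : ℕ → Load V) (t : ℕ) (f' : I.banks),
    dist (ω t).1 (A (I.transcript A ω t) (ω t) : V) +
        dist (A (I.transcript A ω t) (ω t) : V) (ω t).2.1 ≤
      δ * (dist (ω t).1 (f' : V) + dist (f' : V) (ω t).2.1)

/-- The outcome recorded in a transcript is `γ`-multiplicatively envy-free: every individual
receives at least `1 / γ` times what any other individual receives. Only food banks that serve
somebody matter. -/
def EnvyFree (γ : ℝ) (h : I.Transcript) : Prop :=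
  ∀ f f' : I.banks, 0 < I.served f → 0 < I.served f' → I.value h f' ≤ γ * I.value h f

variable [MeasurableSpace V]

/-- The distribution `D` on nodes selects the set of nodes served by a food bank with probability
proportional to the population of that set, up to the factors `1 / α` and `β`. -/
def Biased (α β : ℝ) (D : Measure V) : Prop :=
  ∀ f : I.banks,
    (I.served f : ℝ) / (α * I.total) ≤ D.real {v | I.nearest v = f} ∧
      D.real {v | I.nearest v = f} ≤ β * I.served f / I.total

end Network

/-- The law of the sequence of loads: the loads are independent, and each of them consists of
an origin drawn from `D`, a destination drawn from `D` and a value drawn from `W`, independently. -/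
def loadLaw {V : Type u} [MeasurableSpace V] (D : Measure V) (W : Measure ℝ≥0)
    [IsProbabilityMeasure D] [IsProbabilityMeasure W] : Measure (ℕ → Load V) :=
  Measure.infinitePi fun _ : ℕ => D.prod (D.prod W)

end FoodRescue

end

/-! Driver efficiency is the triangle inequality: the detour to the bank nearest to one endpoint
costs at most twice a leg of any competing route.

Envy is controlled by the potential Φ = ∑ N_f cosh(a(x_f - μ)), where x_f is the value per
individual, μ its population-weighted average and a a small constant. Let π_f = N_f / N, and let q_f
be the probability that f is selected. If T is an upper set of values, the selected bank lies in T
only if both sampled banks do, so q(T) ≤ p(T)² with p the single-sample law. The bias bounds turn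
this into q(T) ≤ π(T) - cπ(T)(1 - π(T)) with c = (1 + 1/β - α)/α², which is positive exactly when
β(α - 1) < 1; both sets of assumptions on α and β imply this inequality (`sum_pairMass_le_of_bias`).

A layer-cake argument around a median converts this domination into a negative first-order drift
proportional to ∑ π|sinh| (`sum_sub_mul_sinh_le`). For small a it beats the second-order term, which
is finite by the exponential moment of the values. So one round multiplies the expected potential by
1 - ac/(12N) and adds at most ac/6 (`sum_drift_le`), and E Φ ≤ 2N at all times
(`Biased.lintegral_potential_le`).

By Markov's inequality Φ is at most polynomial in N, so every bank serving somebody is within O(log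
N) of the average. A Chernoff bound shows that the total value is at least m/2, so the average is at
least m/(2N). Dividing gives ε = O(N log N / m) in both models (`envyFree_core`), which is stronger
than the two stated forms. -/

namespace FoodRescue

/-! ### Stochastic domination against the hyperbolic sine. -/

section FiniteSums

variable {ι : Type*} [Fintype ι]

/-- Layer cake: a signed weight with nonnegative mass on all superlevel sets of a nonnegative
function has a nonnegative pairing with this function. -/
theorem sum_mul_nonneg_of_superlevel (r h : ι → ℝ) (h0 : ∀ i, 0 ≤ h i)
    (H : ∀ θ : ℝ, 0 ≤ θ → 0 ≤ ∑ i with θ < h i, r i) : 0 ≤ ∑ i, r i * h i := by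
  classical
  set B : ℝ := ∑ i, h i with hB
  have hle : ∀ i, h i ≤ B := fun i =>
    Finset.single_le_sum (f := h) (fun j _ => h0 j) (Finset.mem_univ i)
  have hB0 : 0 ≤ B := Finset.sum_nonneg fun i _ => h0 i
  have key : ∀ i, ∫ θ in Set.Ioc 0 B, (Set.Iio (h i)).indicator (fun _ => (1 : ℝ)) θ = h i := by
    intro i
    rw [setIntegral_indicator measurableSet_Iio]
    have : Set.Ioc 0 B ∩ Set.Iio (h i) = Set.Ioo 0 (h i) := by
      ext θ
      simp only [Set.mem_inter_iff, Set.mem_Ioc, Set.mem_Iio, Set.mem_Ioo]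
      exact ⟨fun h => ⟨h.1.1, h.2⟩, fun h => ⟨⟨h.1, h.2.le.trans (hle i)⟩, h.2⟩⟩
    rw [this]
    simp [h0 i]
  have hint : ∀ i, IntegrableOn ((Set.Iio (h i)).indicator (fun _ => (1 : ℝ))) (Set.Ioc 0 B) := by
    intro i
    refine IntegrableOn.indicator ?_ measurableSet_Iio
    simp
  have : ∑ i, r i * h i = ∫ θ in Set.Ioc 0 B, ∑ i,
      r i * (Set.Iio (h i)).indicator (fun _ => (1 : ℝ)) θ := by
    rw [integral_finsetSum _ fun i _ => (hint i).const_mul _]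
    exact Finset.sum_congr rfl fun i _ => by rw [integral_const_mul, key]
  rw [this]
  refine setIntegral_nonneg measurableSet_Ioc fun θ hθ => ?_
  refine (H θ hθ.1.le).trans_eq ?_
  rw [Finset.sum_filter]
  refine Finset.sum_congr rfl fun i _ => ?_
  by_cases hi : θ < h i <;> simp [hi]

/-- The largest value whose closed upper tail has mass at least 1/2 works: if its open tail exceeded
1/2, the next larger value would qualify too. Cutting at a median bounds the mass on either side. -/
theorem exists_median [Nonempty ι] (π z : ι → ℝ) (hπ : ∀ i, 0 ≤ π i) (h1 : ∑ i, π i = 1) :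
    ∃ M : ℝ, 1 / 2 ≤ ∑ i with M ≤ z i, π i ∧ ∑ i with M < z i, π i ≤ 1 / 2 := by
  classical
  obtain ⟨j, hj⟩ := Finite.exists_min z
  set s : Finset ι := {i | 1 / 2 ≤ ∑ k with z i ≤ z k, π k} with hs
  have hjs : j ∈ s := by
    have : ({k | z j ≤ z k} : Finset ι) = Finset.univ := by ext k; simp [hj k]
    simp only [hs, Finset.mem_filter, Finset.mem_univ, true_and, this, h1]
    norm_num
  obtain ⟨i, his, hi⟩ := s.exists_max_image z ⟨j, hjs⟩
  refine ⟨z i, by simpa [hs] using his, ?_⟩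
  by_contra! hcon
  have hne : ({k | z i < z k} : Finset ι).Nonempty := by
    by_contra hne
    rw [Finset.not_nonempty_iff_eq_empty] at hne
    rw [hne] at hcon
    norm_num at hcon
  obtain ⟨l, hl, hlmin⟩ := Finset.exists_min_image _ z hne
  simp only [Finset.mem_filter, Finset.mem_univ, true_and] at hl hlmin
  have hls : l ∈ s := by
    simp only [hs, Finset.mem_filter, Finset.mem_univ, true_and]
    refine hcon.le.trans (Finset.sum_le_sum_of_subset_of_nonneg ?_ fun k _ _ => hπ k)
    intro k hk
    simp only [Finset.mem_filter, Finset.mem_univ, true_and] at hk ⊢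
    exact hlmin k hk
  exact (hi l hls).not_gt hl

theorem sinh_le_mul_cosh {M : ℝ} (hM : 0 ≤ M) : Real.sinh M ≤ M * Real.cosh M := by
  rcases hM.eq_or_lt with rfl | hM
  · simp
  obtain ⟨c, hc, h⟩ := exists_hasDerivAt_eq_slope Real.sinh Real.cosh hM
    Real.continuous_sinh.continuousOn fun x _ => Real.hasDerivAt_sinh x
  rw [Real.sinh_zero, sub_zero, sub_zero, eq_div_iff hM.ne'] at h
  have : Real.cosh c ≤ Real.cosh M := by
    rw [Real.cosh_le_cosh, abs_of_pos hc.1, abs_of_pos hM]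
    exact hc.2.le
  nlinarith

theorem cosh_mul_sub_le_sinh {M u : ℝ} (hM : 0 ≤ M) (hu : 0 ≤ u) :
    Real.cosh M * (u - M) ≤ Real.sinh u := by
  have hc := Real.one_le_cosh M
  rcases le_total u M with h | h
  · have := Real.sinh_nonneg_iff.2 hu
    nlinarith
  · obtain ⟨t, rfl⟩ : ∃ t, u = M + t := ⟨u - M, by ring⟩
    have ht : 0 ≤ t := by linarith
    rw [Real.sinh_add]
    have h1 := Real.self_le_sinh_iff.2 ht
    have h2 := Real.sinh_nonneg_iff.2 hM
    have h3 := Real.one_le_cosh t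
    nlinarith [mul_nonneg h2 (by linarith : (0 : ℝ) ≤ Real.cosh t)]

/-- Half of the mass lies at or above M while the mean is zero, so the rest must compensate far
below M. This forces sinh M ≤ 2 ∑ π|sinh z - sinh M|, and the triangle inequality gives the factor
3. -/
theorem sum_abs_sinh_le_of_nonneg (π z : ι → ℝ) (hπ : ∀ i, 0 ≤ π i) (h1 : ∑ i, π i = 1)
    (hz : ∑ i, π i * z i = 0) {M : ℝ} (hM : 0 ≤ M) (hm : 1 / 2 ≤ ∑ i with M ≤ z i, π i) :
    ∑ i, π i * |Real.sinh (z i)| ≤ 3 * ∑ i, π i * |Real.sinh (z i) - Real.sinh M| := by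
  classical
  set A := Real.sinh M with hA
  set K := Real.cosh M with hK
  have hA0 : 0 ≤ A := Real.sinh_nonneg_iff.2 hM
  have hAK : A ≤ M * K := sinh_le_mul_cosh hM
  have hK1 : 1 ≤ K := Real.one_le_cosh M
  set I : ι → ℝ := fun i => if M ≤ z i then 1 else 0 with hI
  -- A minorant of |sinh z - sinh M| that is affine in z on each side of M, with common slope -cosh
  -- M, so its mean depends only on the mass above M and the mean of z.
  have pt : ∀ i, (1 - I i) * (A - M * K) + K * (M * I i - z i) ≤ |Real.sinh (z i) - A| := by
    intro i
    by_cases hi : M ≤ z i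
    · simp only [hI, hi, if_true]
      exact le_trans (by nlinarith) (abs_nonneg _)
    · simp only [hI, hi, if_false]
      rcases le_or_gt 0 (z i) with h0 | h0
      · exact le_trans (by nlinarith) (abs_nonneg _)
      · have := cosh_mul_sub_le_sinh hM (u := -z i) (by linarith)
        rw [Real.sinh_neg] at this
        refine le_trans ?_ (neg_le_abs _)
        linarith
  have hP : ∑ i, π i * I i = ∑ i with M ≤ z i, π i := by
    simp [hI, Finset.sum_filter]
  have hsum : ∑ i, π i * ((1 - I i) * (A - M * K) + K * (M * I i - z i)) ≤
      ∑ i, π i * |Real.sinh (z i) - A| :=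
    Finset.sum_le_sum fun i _ => mul_le_mul_of_nonneg_left (pt i) (hπ i)
  have heq : ∑ i, π i * ((1 - I i) * (A - M * K) + K * (M * I i - z i)) =
      (∑ i, π i - ∑ i, π i * I i) * (A - M * K) + K * M * ∑ i, π i * I i
        - K * ∑ i, π i * z i := by
    simp only [Finset.mul_sum, sub_mul, Finset.sum_mul, ← Finset.sum_sub_distrib,
      ← Finset.sum_add_distrib]
    exact Finset.sum_congr rfl fun i _ => by ring
  rw [heq, h1, hz, hP] at hsum
  have htri : ∑ i, π i * |Real.sinh (z i)| ≤ ∑ i, π i * |Real.sinh (z i) - A| + A := by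
    calc ∑ i, π i * |Real.sinh (z i)| ≤ ∑ i, (π i * |Real.sinh (z i) - A| + π i * A) := by
          refine Finset.sum_le_sum fun i _ => ?_
          rw [← mul_add]
          refine mul_le_mul_of_nonneg_left ?_ (hπ i)
          have := abs_add_le (Real.sinh (z i) - A) A
          rwa [sub_add_cancel, abs_of_nonneg hA0] at this
      _ = _ := by rw [Finset.sum_add_distrib, ← Finset.sum_mul, h1, one_mul]
  nlinarith

theorem sum_abs_sinh_le (π z : ι → ℝ) (hπ : ∀ i, 0 ≤ π i) (h1 : ∑ i, π i = 1)
    (hz : ∑ i, π i * z i = 0) {M : ℝ} (hm : 1 / 2 ≤ ∑ i with M ≤ z i, π i)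
    (hm' : ∑ i with M < z i, π i ≤ 1 / 2) :
    ∑ i, π i * |Real.sinh (z i)| ≤ 3 * ∑ i, π i * |Real.sinh (z i) - Real.sinh M| := by
  classical
  rcases le_total 0 M with hM | hM
  · exact sum_abs_sinh_le_of_nonneg π z hπ h1 hz hM hm
  · have h := sum_abs_sinh_le_of_nonneg π (fun i => -z i) hπ h1 (by simp [hz]) (M := -M)
      (by linarith) (by
        have := Finset.sum_filter_add_sum_filter_not Finset.univ (fun i => M < z i) π
        simp only [not_lt, h1] at this
        simp only [neg_le_neg_iff]
        linarith)
    simp only [Real.sinh_neg, abs_neg] at h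
    simpa only [neg_sub_neg, abs_sub_comm (Real.sinh M)] using h

/-- If `q` gives less mass than `π` to all upper sets of `z`, then `q` pushes the centred
variable `z` down. -/
theorem sum_sub_mul_sinh_le [Nonempty ι] (π q z : ι → ℝ) (hπ : ∀ i, 0 ≤ π i)
    (h1 : ∑ i, π i = 1) (hq1 : ∑ i, q i = 1) (hz : ∑ i, π i * z i = 0) {c : ℝ} (hc : 0 ≤ c)
    (hT : ∀ T : Finset ι, (∀ i ∈ T, ∀ j ∉ T, z j < z i) →
      ∑ i ∈ T, q i ≤ ∑ i ∈ T, π i - c * ((∑ i ∈ T, π i) * (1 - ∑ i ∈ T, π i))) :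
    ∑ i, (q i - π i) * Real.sinh (z i) ≤ -(c / 6) * ∑ i, π i * |Real.sinh (z i)| := by
  classical
  obtain ⟨M, hM, hM'⟩ := exists_median π z hπ h1
  have hmain := sum_abs_sinh_le π z hπ h1 hz hM hM'
  set A := Real.sinh M with hA
  -- Above the median π(T) ≤ 1/2, so the hypothesis yields q(T) ≤ (1 - c/2) π(T) on every superlevel
  -- set.
  have hpos : 0 ≤ ∑ i, (π i - q i - c / 2 * π i) * max (Real.sinh (z i) - A) 0 := by
    refine sum_mul_nonneg_of_superlevel _ _ (fun i => le_max_right _ _) fun θ hθ => ?_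
    set T : Finset ι := {i | θ < max (Real.sinh (z i) - A) 0} with hTdef
    have hmem : ∀ i, i ∈ T ↔ θ + A < Real.sinh (z i) := by
      intro i
      simp only [hTdef, Finset.mem_filter, Finset.mem_univ, true_and, lt_max_iff]
      constructor
      · rintro (h | h) <;> linarith
      · intro h; left; linarith
    have hup := hT T fun i hi j hj => by
      rw [hmem] at hi hj
      exact Real.sinh_lt_sinh.1 (by linarith)
    have hhalf : ∑ i ∈ T, π i ≤ 1 / 2 := by
      refine le_trans (Finset.sum_le_sum_of_subset_of_nonneg ?_ fun k _ _ => hπ k) hM'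
      intro i hi
      rw [hmem] at hi
      simp only [Finset.mem_filter, Finset.mem_univ, true_and]
      exact Real.sinh_lt_sinh.1 (by linarith)
    have h0 : 0 ≤ ∑ i ∈ T, π i := Finset.sum_nonneg fun i _ => hπ i
    rw [Finset.sum_sub_distrib, Finset.sum_sub_distrib, ← Finset.mul_sum]
    nlinarith [mul_nonneg (mul_nonneg hc h0) (sub_nonneg.2 hhalf)]
  -- Below the median the same argument runs on complements: q(U) ≥ (1 + c/2) π(U) for every
  -- sublevel set U.
  have hneg : 0 ≤ ∑ i, (q i - π i - c / 2 * π i) * max (A - Real.sinh (z i)) 0 := by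
    refine sum_mul_nonneg_of_superlevel _ _ (fun i => le_max_right _ _) fun θ hθ => ?_
    set U : Finset ι := {i | θ < max (A - Real.sinh (z i)) 0} with hUdef
    have hmem : ∀ i, i ∈ U ↔ Real.sinh (z i) < A - θ := by
      intro i
      simp only [hUdef, Finset.mem_filter, Finset.mem_univ, true_and, lt_max_iff]
      constructor
      · rintro (h | h) <;> linarith
      · intro h; left; linarith
    have hup := hT Uᶜ fun i hi j hj => by
      rw [Finset.mem_compl, hmem] at hi
      rw [Finset.mem_compl, hmem, not_not] at hj
      exact Real.sinh_lt_sinh.1 (by linarith)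
    have hhalf : 1 / 2 ≤ ∑ i ∈ Uᶜ, π i := by
      refine le_trans hM (Finset.sum_le_sum_of_subset_of_nonneg ?_ fun k _ _ => hπ k)
      intro i hi
      simp only [Finset.mem_filter, Finset.mem_univ, true_and] at hi
      rw [Finset.mem_compl, hmem]
      have := Real.sinh_le_sinh.2 hi
      linarith
    have hcπ := Finset.sum_add_sum_compl U π
    have hcq := Finset.sum_add_sum_compl U q
    have h0 : 0 ≤ ∑ i ∈ U, π i := Finset.sum_nonneg fun i _ => hπ i
    rw [Finset.sum_sub_distrib, Finset.sum_sub_distrib, ← Finset.mul_sum]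
    have e : ∑ i ∈ U, π i = 1 - ∑ i ∈ Uᶜ, π i := by linarith
    rw [e] at h0 ⊢
    nlinarith [mul_nonneg (mul_nonneg hc h0) (sub_nonneg.2 hhalf)]
  -- The two truncations differ by sinh z - A and add up to |sinh z - A|. The constant A drops out
  -- since q and π have equal mass, and c/6 is c/2 divided by the 3 of `hmain`.
  have hsplit : ∑ i, (π i - q i - c / 2 * π i) * max (Real.sinh (z i) - A) 0 +
      ∑ i, (q i - π i - c / 2 * π i) * max (A - Real.sinh (z i)) 0 =
      -∑ i, (q i - π i) * Real.sinh (z i) + A * (∑ i, q i - ∑ i, π i)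
        - c / 2 * ∑ i, π i * |Real.sinh (z i) - A| := by
    simp only [Finset.mul_sum, ← Finset.sum_sub_distrib, ← Finset.sum_add_distrib,
      ← Finset.sum_neg_distrib]
    refine Finset.sum_congr rfl fun i _ => ?_
    rcases le_total (Real.sinh (z i)) A with h | h
    · rw [max_eq_right (by linarith), max_eq_left (by linarith), abs_of_nonpos (by linarith)]
      ring
    · rw [max_eq_left (by linarith), max_eq_right (by linarith), abs_of_nonneg (by linarith)]
      ring
  rw [h1, hq1, sub_self, mul_zero, add_zero] at hsplit
  nlinarith

end FiniteSums

/-! ### Second-order bounds and the bias inequality. -/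

theorem exp_le_one_add_add_sq (x : ℝ) : Real.exp x ≤ 1 + x + x ^ 2 * Real.exp |x| := by
  have h1 : Real.exp x ≤ 1 + x * Real.exp x := by
    have := mul_le_mul_of_nonneg_left (Real.one_sub_le_exp_neg x) (Real.exp_pos x).le
    rw [← Real.exp_add, add_neg_cancel, Real.exp_zero] at this
    linarith
  rcases le_total 0 x with hx | hx
  · rw [abs_of_nonneg hx]
    nlinarith [mul_le_mul_of_nonneg_left h1 hx]
  · have h2 := Real.add_one_le_exp x
    have h3 : 1 ≤ Real.exp |x| := Real.one_le_exp (abs_nonneg x)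
    nlinarith [mul_le_mul_of_nonneg_left h3 (sq_nonneg x)]

theorem cosh_add_le (z x : ℝ) :
    Real.cosh (z + x) ≤ Real.cosh z + x * Real.sinh z + x ^ 2 * Real.exp |x| * Real.cosh z := by
  have h1 := mul_le_mul_of_nonneg_left (exp_le_one_add_add_sq x) (Real.exp_pos z).le
  have h2 := mul_le_mul_of_nonneg_left (exp_le_one_add_add_sq (-x)) (Real.exp_pos (-z)).le
  rw [← Real.exp_add] at h1 h2
  rw [abs_neg, neg_sq] at h2
  rw [Real.cosh_eq, Real.cosh_eq, Real.sinh_eq, neg_add]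
  linarith

/-- Write s - p² = s(1 - p) + p(1 - p) - p(1 - s). Here s ≥ p/β and 1 - s ≤ α(1 - p) give s - p² ≥
(1 + 1/β - α) p(1 - p), and p(1 - p) ≥ s(1 - s)/α². -/
theorem sq_le_sub_of_bias {α β s p : ℝ} (hα : 1 ≤ α) (hβ : 1 ≤ β) (hαβ : β * (α - 1) < 1)
    (hs1 : s ≤ 1) (hp0 : 0 ≤ p) (hp1 : p ≤ 1) (hpβ : p ≤ β * s)
    (hsα : s ≤ α * p) (hsα' : 1 - s ≤ α * (1 - p)) :
    p ^ 2 ≤ s - (1 + 1 / β - α) / α ^ 2 * (s * (1 - s)) := by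
  have hβ0 : 0 < β := by linarith
  have hα0 : 0 < α := by linarith
  have hc0 : 0 ≤ 1 + 1 / β - α := by
    have : α - 1 ≤ 1 / β := by
      rw [le_div_iff₀ hβ0]
      linarith
    linarith
  have h1 : s * (1 - s) ≤ α ^ 2 * (p * (1 - p)) := by
    calc s * (1 - s) ≤ (α * p) * (α * (1 - p)) :=
          mul_le_mul hsα hsα' (by linarith) (by positivity)
      _ = _ := by ring
  have h2 : (1 + 1 / β - α) / α ^ 2 * (s * (1 - s)) ≤ (1 + 1 / β - α) * (p * (1 - p)) := by
    rw [div_mul_eq_mul_div, div_le_iff₀ (by positivity)]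
    nlinarith
  have h3 : 1 / β * p ≤ s := by
    rw [div_mul_eq_mul_div, one_mul, div_le_iff₀ hβ0]
    linarith
  have h4 : (1 + 1 / β - α) * (p * (1 - p)) ≤ s - p ^ 2 := by
    nlinarith [mul_le_mul_of_nonneg_left h3 (sub_nonneg.2 hp1),
      mul_le_mul_of_nonneg_left hsα' hp0]
  linarith

/-! ### The law of the selected bank. -/

section TwoChoice

variable {V ι : Type*} [Fintype V]

open Classical in
/-- The mass of the fibre of `b` over `i`. -/
noncomputable def fibreMass (d : V → ℝ) (b : V → ι) (i : ι) : ℝ := ∑ u, d u * if b u = i then 1 else 0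

open Classical in
/-- The mass of the pairs for which `ch` takes the value `i`. -/
noncomputable def pairMass (d : V → ℝ) (ch : V → V → ι) (i : ι) : ℝ :=
  ∑ u, ∑ v, d u * d v * if ch u v = i then 1 else 0

open Classical in
theorem sum_fibreMass (d : V → ℝ) (b : V → ι) (T : Finset ι) :
    ∑ i ∈ T, fibreMass d b i = ∑ u, d u * if b u ∈ T then 1 else 0 := by
  unfold fibreMass
  rw [Finset.sum_comm]
  refine Finset.sum_congr rfl fun u _ => ?_
  rw [← Finset.mul_sum]
  simp

open Classical in
theorem sum_pairMass (d : V → ℝ) (ch : V → V → ι) (T : Finset ι) :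
    ∑ i ∈ T, pairMass d ch i = ∑ u, ∑ v, d u * d v * if ch u v ∈ T then 1 else 0 := by
  unfold pairMass
  rw [Finset.sum_comm]
  refine Finset.sum_congr rfl fun u _ => ?_
  rw [Finset.sum_comm]
  refine Finset.sum_congr rfl fun v _ => ?_
  rw [← Finset.mul_sum]
  simp

variable {d : V → ℝ} {b : V → ι} {ch : V → V → ι} {x : ι → ℝ}

theorem pairMass_nonneg (hd : ∀ u, 0 ≤ d u) (i : ι) : 0 ≤ pairMass d ch i := by
  classical
  exact Finset.sum_nonneg fun u _ => Finset.sum_nonneg fun v _ =>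
    mul_nonneg (mul_nonneg (hd u) (hd v)) (by split_ifs <;> norm_num)

theorem sum_pairMass_univ [Fintype ι] (hd1 : ∑ u, d u = 1) : ∑ i, pairMass d ch i = 1 := by
  rw [sum_pairMass]
  simp [← Finset.mul_sum, hd1]

/-- Union bound over the two endpoints; it controls the second-order term of the drift. -/
theorem pairMass_le (hd : ∀ u, 0 ≤ d u) (hd1 : ∑ u, d u = 1)
    (hch : ∀ u v, ch u v = b u ∨ ch u v = b v) (i : ι) :
    pairMass d ch i ≤ 2 * fibreMass d b i := by
  classical
  calc pairMass d ch i
      ≤ ∑ u, ∑ v, ((d u * if b u = i then 1 else 0) * d v +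
          d u * (d v * if b v = i then 1 else 0)) := by
        refine Finset.sum_le_sum fun u _ => Finset.sum_le_sum fun v _ => ?_
        have h0 := mul_nonneg (hd u) (hd v)
        rcases hch u v with h | h <;> rw [h] <;> split_ifs <;> nlinarith
    _ = _ := by
        simp only [Finset.sum_add_distrib, ← Finset.mul_sum, ← Finset.sum_mul, hd1]
        unfold fibreMass
        ring

/-- The smaller of two values lies in an upper set only if both do. -/
theorem sum_pairMass_le_sq (hd : ∀ u, 0 ≤ d u)
    (hx : ∀ u v, x (ch u v) ≤ x (b u) ∧ x (ch u v) ≤ x (b v)) (T : Finset ι)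
    (hT : ∀ i ∈ T, ∀ j ∉ T, x j < x i) :
    ∑ i ∈ T, pairMass d ch i ≤ (∑ i ∈ T, fibreMass d b i) ^ 2 := by
  classical
  rw [sum_pairMass, sum_fibreMass, sq, Finset.sum_mul_sum]
  refine Finset.sum_le_sum fun u _ => Finset.sum_le_sum fun v _ => ?_
  have h0 := mul_nonneg (hd u) (hd v)
  by_cases hc : ch u v ∈ T
  · have h1 : b u ∈ T := by
      by_contra h
      exact (hT _ hc _ h).not_ge (hx u v).1
    have h2 : b v ∈ T := by
      by_contra h
      exact (hT _ hc _ h).not_ge (hx u v).2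
    simp [hc, h1, h2]
  · simp only [hc, if_false, mul_zero]
    exact mul_nonneg (mul_nonneg (hd u) (by split_ifs <;> norm_num))
      (mul_nonneg (hd v) (by split_ifs <;> norm_num))

theorem sum_pairMass_le_of_bias [Fintype ι] {α β : ℝ} {π : ι → ℝ} (hα : 1 ≤ α) (hβ : 1 ≤ β)
    (hαβ : β * (α - 1) < 1) (hd : ∀ u, 0 ≤ d u) (hd1 : ∑ u, d u = 1)
    (hx : ∀ u v, x (ch u v) ≤ x (b u) ∧ x (ch u v) ≤ x (b v))
    (hπ : ∀ i, 0 ≤ π i) (hπ1 : ∑ i, π i = 1)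
    (hlow : ∀ i, π i ≤ α * fibreMass d b i) (hupp : ∀ i, fibreMass d b i ≤ β * π i)
    (T : Finset ι) (hT : ∀ i ∈ T, ∀ j ∉ T, x j < x i) :
    ∑ i ∈ T, pairMass d ch i ≤ ∑ i ∈ T, π i -
      (1 + 1 / β - α) / α ^ 2 * ((∑ i ∈ T, π i) * (1 - ∑ i ∈ T, π i)) := by
  classical
  have hp : ∀ i, 0 ≤ fibreMass d b i := fun i =>
    Finset.sum_nonneg fun u _ => mul_nonneg (hd u) (by split_ifs <;> norm_num)
  have hp1 : ∑ i, fibreMass d b i = 1 := by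
    rw [sum_fibreMass]
    simpa using hd1
  have cp := Finset.sum_add_sum_compl T (fibreMass d b)
  have cπ := Finset.sum_add_sum_compl T π
  rw [hp1] at cp
  rw [hπ1] at cπ
  refine (sum_pairMass_le_sq hd hx T hT).trans (sq_le_sub_of_bias hα hβ hαβ
    ?_ (Finset.sum_nonneg fun i _ => hp i) ?_ ?_ ?_ ?_)
  · linarith [Finset.sum_nonneg (s := Tᶜ) fun i _ => hπ i]
  · linarith [Finset.sum_nonneg (s := Tᶜ) fun i _ => hp i]
  · rw [Finset.mul_sum]
    exact Finset.sum_le_sum fun i _ => hupp i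
  · rw [Finset.mul_sum]
    exact Finset.sum_le_sum fun i _ => hlow i
  · have : ∑ i ∈ Tᶜ, π i ≤ α * ∑ i ∈ Tᶜ, fibreMass d b i := by
      rw [Finset.mul_sum]
      exact Finset.sum_le_sum fun i _ => hlow i
    rwa [← eq_sub_of_add_eq' cπ, ← eq_sub_of_add_eq' cp]

end TwoChoice

/-! ### The potential and its change under one donation. -/

section Potential

variable {ι : Type*} [Fintype ι]

/-- The weighted average of `x`. -/
noncomputable def average (n : ι → ℕ) (x : ι → ℝ) : ℝ := (∑ i, n i * x i) / ∑ i, (n i : ℝ)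

/-- The hyperbolic cosine potential: large as soon as some value is far from the average. -/
noncomputable def potential (n : ι → ℕ) (a : ℝ) (x : ι → ℝ) : ℝ :=
  ∑ i, n i * Real.cosh (a * (x i - average n x))

open Classical in
/-- The values after `j` has received `w`. -/
noncomputable def receive (n : ι → ℕ) (x : ι → ℝ) (j : ι) (w : ℝ) (i : ι) : ℝ :=
  x i + (if j = i then w else 0) / n i

theorem sum_mul_receive (n : ι → ℕ) (x : ι → ℝ) {j : ι} (hj : n j ≠ 0) (w : ℝ) :
    ∑ i, n i * receive n x j w i = ∑ i, n i * x i + w := by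
  classical
  have : ∀ i, (n i : ℝ) * receive n x j w i = n i * x i + if j = i then w else 0 := by
    intro i
    unfold receive
    split_ifs with h
    · subst h
      field_simp
    · simp
  simp [this, Finset.sum_add_distrib]

theorem average_receive (n : ι → ℕ) (x : ι → ℝ) {j : ι} (hj : n j ≠ 0) (w : ℝ) :
    average n (receive n x j w) = average n x + w / ∑ i, (n i : ℝ) := by
  unfold average
  rw [sum_mul_receive n x hj, add_div]

theorem sum_mul_sub_average (n : ι → ℕ) (x : ι → ℝ) (hn : ∑ i, (n i : ℝ) ≠ 0) :
    ∑ i, n i * (x i - average n x) = 0 := by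
  simp only [mul_sub, Finset.sum_sub_distrib, ← Finset.sum_mul]
  unfold average
  field_simp
  ring

open Classical in
/-- The derivative of the potential when `j` receives a donation. -/
noncomputable def potentialSlope (n : ι → ℕ) (a : ℝ) (x : ι → ℝ) (j : ι) : ℝ :=
  ∑ i, ((if j = i then 1 else 0) - n i / ∑ k, (n k : ℝ)) * Real.sinh (a * (x i - average n x))

open Classical in
/-- A bound for the second derivative of the potential when `j` receives a donation. -/
noncomputable def potentialCurvature (n : ι → ℕ) (a : ℝ) (x : ι → ℝ) (j : ι) : ℝ :=
  ∑ i, ((if j = i then 1 else 0) / (n i : ℝ) + n i / ∑ k, (n k : ℝ)) *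
    Real.cosh (a * (x i - average n x))

theorem potentialCurvature_nonneg (n : ι → ℕ) (a : ℝ) (x : ι → ℝ) (j : ι) :
    0 ≤ potentialCurvature n a x j := by
  refine Finset.sum_nonneg fun i _ => mul_nonneg (add_nonneg (div_nonneg ?_
    (Nat.cast_nonneg _)) (by positivity)) (Real.cosh_pos _).le
  split_ifs <;> norm_num

theorem potential_receive_le (n : ι → ℕ) (x : ι → ℝ) {j : ι} (hj : n j ≠ 0) {a w : ℝ}
    (ha : 0 ≤ a) (hw : 0 ≤ w) :
    potential n a (receive n x j w) ≤ potential n a x +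
      a * w * potentialSlope n a x j +
      a ^ 2 * (w ^ 2 * Real.exp (a * w)) * potentialCurvature n a x j := by
  classical
  unfold potential potentialSlope potentialCurvature
  rw [average_receive n x hj, Finset.mul_sum, Finset.mul_sum, ← Finset.sum_add_distrib,
    ← Finset.sum_add_distrib]
  refine Finset.sum_le_sum fun i _ => ?_
  set N : ℝ := ∑ k, (n k : ℝ) with hN
  set e : ℝ := if j = i then 1 else 0 with he
  set z : ℝ := a * (x i - average n x) with hz
  have hr : receive n x j w i = x i + w * (e / n i) := by
    unfold receive
    rw [he]
    split_ifs <;> ring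
  have hnN : (n i : ℝ) ≤ N :=
    Finset.single_le_sum (f := fun k => (n k : ℝ)) (fun k _ => Nat.cast_nonneg _)
      (Finset.mem_univ i)
  have hch : 0 ≤ Real.cosh z := (Real.cosh_pos z).le
  rcases Nat.eq_zero_or_pos (n i) with h0 | h0
  · have hji : j ≠ i := by
      rintro rfl
      exact hj h0
    simp [h0, he, hji]
  have h1 : (1 : ℝ) ≤ n i := by exact_mod_cast h0
  have hN1 : 1 ≤ N := h1.trans hnN
  have he01 : e = 0 ∨ e = 1 := by
    rw [he]
    split_ifs <;> simp
  set δ : ℝ := a * w * (e / n i - 1 / N) with hδ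
  have hzz : a * (receive n x j w i - (average n x + w / N)) = z + δ := by
    rw [hr, hz, hδ]
    ring
  rw [hzz]
  have hinv : 1 / N ≤ 1 / (n i : ℝ) := one_div_le_one_div_of_le (by linarith) hnN
  have hinv1 : 1 / (n i : ℝ) ≤ 1 := by
    rw [div_le_one (by linarith)]
    exact h1
  have hNi : 0 < 1 / N := by positivity
  have hdabs : |e / n i - 1 / N| ≤ 1 := by
    rw [abs_le]
    rcases he01 with h | h <;> rw [h]
    · constructor <;> simp only [zero_div] <;> linarith
    · constructor <;> linarith
  have hδabs : |δ| ≤ a * w := by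
    rw [hδ, abs_mul, abs_of_nonneg (mul_nonneg ha hw)]
    exact mul_le_of_le_one_right (mul_nonneg ha hw) hdabs
  -- The weight `n i` absorbs one of the two factors 1/n_i or 1/N, leaving the coefficient in
  -- `potentialCurvature`.
  have hsq : n i * (e / n i - 1 / N) ^ 2 ≤ e / n i + n i / N := by
    rcases he01 with h | h <;> rw [h]
    · have : (n i : ℝ) * (1 / N) ^ 2 ≤ n i * (1 / N) := by
        refine mul_le_mul_of_nonneg_left ?_ (by linarith)
        nlinarith
      simp only [zero_div, zero_sub, neg_sq, zero_add]
      rwa [div_eq_mul_one_div (n i : ℝ) N]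
    · have h2 : (1 / (n i : ℝ) - 1 / N) ^ 2 ≤ (1 / (n i : ℝ)) ^ 2 :=
        pow_le_pow_left₀ (by linarith) (by linarith) 2
      have h3 : (n i : ℝ) * (1 / (n i : ℝ)) ^ 2 = 1 / n i := by
        field_simp
      have h4 : 0 ≤ (n i : ℝ) / N := by positivity
      nlinarith
  have hexp : Real.exp |δ| ≤ Real.exp (a * w) := Real.exp_le_exp.2 hδabs
  calc n i * Real.cosh (z + δ)
      ≤ n i * (Real.cosh z + δ * Real.sinh z + δ ^ 2 * Real.exp |δ| * Real.cosh z) :=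
        mul_le_mul_of_nonneg_left (cosh_add_le z δ) (by linarith)
    _ = n i * Real.cosh z + n i * δ * Real.sinh z +
          a ^ 2 * w ^ 2 * (n i * (e / n i - 1 / N) ^ 2) * Real.exp |δ| * Real.cosh z := by
        rw [hδ]
        ring
    _ ≤ n i * Real.cosh z + n i * δ * Real.sinh z +
          a ^ 2 * w ^ 2 * (e / n i + n i / N) * Real.exp (a * w) * Real.cosh z := by
        gcongr
    _ = _ := by
        have : n i * δ = a * w * (e - n i / N) := by
          rw [hδ]
          field_simp
        rw [this]
        ring

end Potential

/-! ### Expected change of the potential over a random pair of endpoints. -/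

section Drift

variable {V ι : Type*} [Fintype V] [Fintype ι] {d : V → ℝ} {b : V → ι} {ch : V → V → ι}
  {x : ι → ℝ}

/-- The average of the first and second order terms of `potential_receive_le`. -/
theorem sum_drift_le {n : ι → ℕ} {α β a S : ℝ} (hα : 1 ≤ α) (hβ : 1 ≤ β)
    (hαβ : β * (α - 1) < 1) (hd : ∀ u, 0 ≤ d u) (hd1 : ∑ u, d u = 1)
    (hch : ∀ u v, ch u v = b u ∨ ch u v = b v)
    (hx : ∀ u v, x (ch u v) ≤ x (b u) ∧ x (ch u v) ≤ x (b v))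
    (hn : 0 < ∑ i, (n i : ℝ))
    (hlow : ∀ i, n i / (α * ∑ k, (n k : ℝ)) ≤ fibreMass d b i)
    (hupp : ∀ i, fibreMass d b i ≤ β * n i / ∑ k, (n k : ℝ))
    (ha : 0 < a) (hS : 0 ≤ S)
    (haS : a * (S * (2 * β + 1)) ≤ (1 + 1 / β - α) / α ^ 2 / 12) :
    ∑ u, ∑ v, d u * d v * (potential n a x + a * potentialSlope n a x (ch u v) +
      a ^ 2 * S * potentialCurvature n a x (ch u v)) ≤
    (1 - a * ((1 + 1 / β - α) / α ^ 2) / (12 * ∑ i, (n i : ℝ))) * potential n a x +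
      a * ((1 + 1 / β - α) / α ^ 2) / 6 := by
  classical
  unfold potentialSlope potentialCurvature
  set N : ℝ := ∑ k, (n k : ℝ) with hN
  set c : ℝ := (1 + 1 / β - α) / α ^ 2 with hc
  set z : ι → ℝ := fun i => a * (x i - average n x) with hz
  set q : ι → ℝ := pairMass d ch with hq
  set π : ι → ℝ := fun i => n i / N with hπdef
  have hβ0 : 0 < β := by linarith
  have hα0 : 0 < α := by linarith
  have hc0 : 0 ≤ c := by
    have : α - 1 ≤ 1 / β := by
      rw [le_div_iff₀ hβ0]
      linarith
    exact div_nonneg (by linarith) (by positivity)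
  have hπ : ∀ i, 0 ≤ π i := fun i => by positivity
  have hπ1 : ∑ i, π i = 1 := by
    rw [← Finset.sum_div]
    exact div_self hn.ne'
  have hne : Nonempty ι := by
    by_contra h
    rw [not_nonempty_iff] at h
    simp [hN] at hn
  have hzπ : ∑ i, π i * z i = 0 := by
    have := sum_mul_sub_average n x hn.ne'
    calc ∑ i, π i * z i = a / N * ∑ i, n i * (x i - average n x) := by
          rw [Finset.mul_sum]
          exact Finset.sum_congr rfl fun i _ => by simp only [hπdef, hz]; ring
      _ = 0 := by rw [this, mul_zero]
  have hswap : ∀ f : ι → ℝ, ∑ u, ∑ v, d u * d v * ∑ i, (if ch u v = i then 1 else 0) * f i =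
      ∑ i, q i * f i := by
    intro f
    simp only [hq, pairMass, Finset.sum_mul, Finset.mul_sum]
    rw [Finset.sum_congr rfl fun u _ => Finset.sum_comm, Finset.sum_comm]
    refine Finset.sum_congr rfl fun i _ => ?_
    exact Finset.sum_congr rfl fun u _ => Finset.sum_congr rfl fun v _ => by ring
  have hconst : ∀ t : ℝ, ∑ u, ∑ v, d u * d v * t = t := by
    intro t
    simp only [← Finset.sum_mul, ← Finset.mul_sum, hd1, one_mul]
  have heq : ∑ u, ∑ v, d u * d v * (potential n a x +
      a * ∑ i, ((if ch u v = i then 1 else 0) - n i / N) * Real.sinh (z i) +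
      a ^ 2 * S * ∑ i, ((if ch u v = i then 1 else 0) / (n i : ℝ) + n i / N) *
          Real.cosh (z i)) =
      potential n a x + a * ∑ i, (q i - π i) * Real.sinh (z i) +
        a ^ 2 * S * ∑ i, (q i / n i + π i) * Real.cosh (z i) := by
    have e1 : ∀ u v, d u * d v * (potential n a x +
      a * ∑ i, ((if ch u v = i then 1 else 0) - n i / N) * Real.sinh (z i) +
      a ^ 2 * S * ∑ i, ((if ch u v = i then 1 else 0) / (n i : ℝ) + n i / N) *
          Real.cosh (z i)) =
        d u * d v * (potential n a x - a * ∑ i, π i * Real.sinh (z i) +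
          a ^ 2 * S * ∑ i, π i * Real.cosh (z i)) +
        d u * d v * ∑ i, (if ch u v = i then 1 else 0) *
          (a * Real.sinh (z i) + a ^ 2 * S * (Real.cosh (z i) / n i)) := by
      intro u v
      rw [← mul_add]
      congr 1
      simp only [Finset.mul_sum]
      rw [add_assoc, ← Finset.sum_add_distrib, sub_eq_add_neg, ← Finset.sum_neg_distrib,
        add_assoc, add_assoc, ← Finset.sum_add_distrib, ← Finset.sum_add_distrib]
      congr 1
      exact Finset.sum_congr rfl fun i _ => by simp only [hπdef]; ring
    simp only [e1, Finset.sum_add_distrib, hconst, hswap]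
    simp only [Finset.mul_sum]
    rw [add_assoc, add_assoc, sub_eq_add_neg, ← Finset.sum_neg_distrib, add_assoc,
      ← Finset.sum_add_distrib, ← Finset.sum_add_distrib, ← Finset.sum_add_distrib]
    congr 1
    exact Finset.sum_congr rfl fun i _ => by ring
  rw [heq]
  have hpot : potential n a x = N * ∑ i, π i * Real.cosh (z i) := by
    rw [Finset.mul_sum]
    refine Finset.sum_congr rfl fun i _ => ?_
    simp only [hπdef, hz]
    field_simp
  have hfirst : ∑ i, (q i - π i) * Real.sinh (z i) ≤ -(c / 6) * (potential n a x / N - 1) := by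
    refine (sum_sub_mul_sinh_le π q z hπ hπ1 (sum_pairMass_univ hd1) hzπ hc0
      fun T hT => ?_).trans ?_
    · refine sum_pairMass_le_of_bias hα hβ hαβ hd hd1 hx hπ hπ1 (fun i => ?_) (fun i => ?_) T ?_
      · have := hlow i
        rw [div_le_iff₀ (by positivity)] at this
        simp only [hπdef]
        rw [div_le_iff₀ hn]
        linarith
      · simpa only [hπdef, mul_div_assoc] using hupp i
      · intro i hi j hj
        have := hT i hi j hj
        simp only [hz] at this
        have := lt_of_mul_lt_mul_left this ha.le
        linarith
    -- Passing from |sinh| to cosh - 1 expresses the drift through the potential itself; the lost 1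
    -- becomes the additive term.
    · have hcs : ∀ i, Real.cosh (z i) - 1 ≤ |Real.sinh (z i)| := by
        intro i
        have h1 := Real.cosh_sq (z i)
        have h2 := Real.one_le_cosh (z i)
        rw [← Real.sqrt_sq_eq_abs]
        refine Real.le_sqrt_of_sq_le ?_
        nlinarith
      have : potential n a x / N - 1 ≤ ∑ i, π i * |Real.sinh (z i)| := by
        rw [hpot, mul_div_cancel_left₀ _ hn.ne', ← hπ1, ← Finset.sum_sub_distrib]
        refine Finset.sum_le_sum fun i _ => ?_
        have := mul_le_mul_of_nonneg_left (hcs i) (hπ i)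
        linarith
      nlinarith
  have hsecond : ∑ i, (q i / n i + π i) * Real.cosh (z i) ≤
      (2 * β + 1) * (potential n a x / N) := by
    rw [hpot, mul_div_cancel_left₀ _ hn.ne', Finset.mul_sum]
    refine Finset.sum_le_sum fun i _ => ?_
    rw [← mul_assoc]
    refine mul_le_mul_of_nonneg_right ?_ (Real.cosh_pos _).le
    have hq2 : q i / n i ≤ 2 * β * π i := by
      rcases Nat.eq_zero_or_pos (n i) with h0 | h0
      · simp [h0, hπdef]
      have h1 : (1 : ℝ) ≤ n i := by exact_mod_cast h0
      have h2 : q i ≤ 2 * β * π i := by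
        have h3 := pairMass_le hd hd1 hch i
        have h4 := hupp i
        rw [mul_div_assoc] at h4
        simp only [hq, hπdef]
        linarith
      exact (div_le_self (pairMass_nonneg hd i) h1).trans h2
    linarith
  have hpot0 : 0 ≤ potential n a x / N := by
    refine div_nonneg (Finset.sum_nonneg fun i _ => ?_) hn.le
    exact mul_nonneg (Nat.cast_nonneg _) (Real.cosh_pos _).le
  have h1 := mul_le_mul_of_nonneg_left hfirst ha.le
  have h2 := mul_le_mul_of_nonneg_left hsecond (mul_nonneg (sq_nonneg a) hS)
  have h3 := mul_le_mul_of_nonneg_left haS (mul_nonneg ha.le hpot0)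
  have h4 : a * c / (12 * N) * potential n a x = a * c / 12 * (potential n a x / N) := by
    field_simp
  rw [sub_mul, one_mul, h4]
  -- By `haS` the second-order term costs at most half of the drift: c/6 - c/12 = c/12.
  nlinarith

end Drift
-- Processes driven by independent loads, and moments of the donations.
section DrivenSequence

variable {E L : Type*} [MeasurableSpace E] [MeasurableSpace L]

/-- A process driven by independent inputs: the state after round `t` is independent of the
next input. -/
theorem lintegral_process_succ (P : Measure L) [IsProbabilityMeasure P] (F : ℕ → E × L → E)
    (hF : ∀ t, Measurable (F t)) (X : ℕ → (ℕ → L) → E) (x₀ : E) (hX0 : ∀ ω, X 0 ω = x₀)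
    (hX : ∀ t ω, X (t + 1) ω = F t (X t ω, ω t)) (hXm : ∀ t, Measurable (X t))
    (g : E → ENNReal) (hg : Measurable g) (t : ℕ) :
    ∫⁻ ω, g (X (t + 1) ω) ∂(Measure.infinitePi fun _ : ℕ => P) =
      ∫⁻ ω, ∫⁻ ℓ, g (F t (X t ω, ℓ)) ∂P ∂(Measure.infinitePi fun _ : ℕ => P) := by
  classical
  have hL : Nonempty L := nonempty_of_isProbabilityMeasure P
  obtain ⟨ℓ₀⟩ := hL
  set Q : Measure (ℕ → L) := Measure.infinitePi fun _ : ℕ => P with hQ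
  have hdep : ∀ t ω ω', (∀ i < t, ω i = ω' i) → X t ω = X t ω' := by
    intro t
    induction t with
    | zero => intro ω ω' _; rw [hX0, hX0]
    | succ t ih =>
      intro ω ω' h
      rw [hX, hX, ih ω ω' fun i hi => h i (hi.trans t.lt_succ_self), h t t.lt_succ_self]
  -- Padding a finite prefix with a dummy input shows that the state factors through the first t
  -- inputs, hence is independent of input t.
  let ext : (Finset.range t → L) → ℕ → L := fun r i =>
    if h : i ∈ Finset.range t then r ⟨i, h⟩ else ℓ₀
  have hext : Measurable ext := by
    refine measurable_pi_lambda _ fun i => ?_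
    by_cases h : i ∈ Finset.range t
    · simp only [ext, h, dif_pos]
      exact measurable_pi_apply _
    · simp only [ext, h, dif_neg, not_false_iff]
      exact measurable_const
  have hind : ProbabilityTheory.IndepFun (X t) (fun ω : ℕ → L => ω t) Q := by
    have h := (ProbabilityTheory.iIndepFun_infinitePi (P := fun _ : ℕ => P)
      (X := fun _ ℓ => ℓ) fun _ => measurable_id).indepFun_finset (Finset.range t) {t}
      (by simp) fun i => measurable_pi_apply i
    have h2 : ProbabilityTheory.IndepFun
        (fun ω : ℕ → L => X t (ext fun i : Finset.range t => ω i)) (fun ω : ℕ → L => ω t) Q :=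
      h.comp (φ := fun r => X t (ext r)) (ψ := fun r : ({t} : Finset ℕ) → L =>
      r ⟨t, Finset.mem_singleton_self t⟩) ((hXm t).comp hext)
        (measurable_pi_apply (⟨t, Finset.mem_singleton_self t⟩ : ({t} : Finset ℕ)))
    refine h2.congr (Filter.Eventually.of_forall fun ω => ?_) (Filter.Eventually.of_forall
      fun ω => rfl)
    refine hdep t _ _ fun i hi => ?_
    simp [ext, hi]
  have hmap := (ProbabilityTheory.indepFun_iff_map_prod_eq_prod_map_map (hXm t).aemeasurable
    (measurable_pi_apply t).aemeasurable).1 hind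
  have heval : Q.map (fun ω : ℕ → L => ω t) = P :=
    (measurePreserving_eval_infinitePi (fun _ : ℕ => P) t).map_eq
  rw [heval] at hmap
  have hgF : Measurable fun y : E × L => g (F t y) := hg.comp (hF t)
  calc ∫⁻ ω, g (X (t + 1) ω) ∂Q = ∫⁻ ω, g (F t (X t ω, ω t)) ∂Q := by simp only [hX]
    _ = ∫⁻ y, g (F t y) ∂(Q.map fun ω => (X t ω, ω t)) :=
        (lintegral_map hgF ((hXm t).prodMk (measurable_pi_apply t))).symm
    _ = ∫⁻ x, ∫⁻ ℓ, g (F t (x, ℓ)) ∂P ∂(Q.map (X t)) := by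
        rw [hmap, lintegral_prod _ hgF.aemeasurable]
    _ = _ := lintegral_map hgF.lintegral_prod_right' (hXm t)

end DrivenSequence

section OneLoad

variable {V : Type u} [Fintype V] [MeasurableSpace V] [DiscreteMeasurableSpace V]

/-- The bound is required only for pairs of positive mass, because donations to a bank serving
nobody are not accounted for by its value. -/
theorem lintegral_load_le (D : Measure V) [IsProbabilityMeasure D] (W : Measure ℝ≥0)
    [IsProbabilityMeasure W] (g : Load V → ENNReal) (hg : Measurable g) (h : V → V → ℝ)
    (hgh : ∀ u v, D.real {u} * D.real {v} ≠ 0 →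
      0 ≤ h u v ∧ ∫⁻ w, g (u, v, w) ∂W ≤ ENNReal.ofReal (h u v)) :
    ∫⁻ ℓ, g ℓ ∂(D.prod (D.prod W)) ≤
      ENNReal.ofReal (∑ u, ∑ v, D.real {u} * D.real {v} * h u v) := by
  have hterm : ∀ u v, 0 ≤ D.real {u} * D.real {v} * h u v := by
    intro u v
    by_cases h0 : D.real {u} * D.real {v} = 0
    · rw [h0, zero_mul]
    · exact mul_nonneg (by positivity) (hgh u v h0).1
  rw [lintegral_prod _ hg.aemeasurable, lintegral_fintype,
    ENNReal.ofReal_sum_of_nonneg fun u _ => Finset.sum_nonneg fun v _ => hterm u v]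
  refine Finset.sum_le_sum fun u _ => ?_
  have hgu : Measurable fun y : V × ℝ≥0 => g (u, y) := hg.comp measurable_prodMk_left
  rw [lintegral_prod _ hgu.aemeasurable, lintegral_fintype,
    ENNReal.ofReal_sum_of_nonneg fun v _ => hterm u v, Finset.sum_mul]
  refine Finset.sum_le_sum fun v _ => ?_
  by_cases h0 : D.real {u} * D.real {v} = 0
  · rw [h0, zero_mul, ENNReal.ofReal_zero, nonpos_iff_eq_zero]
    rcases mul_eq_zero.1 h0 with h1 | h1
    · rw [measureReal_eq_zero_iff] at h1
      rw [h1, mul_zero]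
    · rw [measureReal_eq_zero_iff] at h1
      rw [h1, mul_zero, zero_mul]
  · have e : ∀ v, D {v} = ENNReal.ofReal (D.real {v}) := fun v => by simp
    rw [ENNReal.ofReal_mul (by positivity), ENNReal.ofReal_mul (by positivity), ← e, ← e]
    calc _ ≤ ENNReal.ofReal (h u v) * D {v} * D {u} := by
          gcongr
          exact (hgh u v h0).2
      _ = _ := by ring

end OneLoad

section Donations

variable {W : Measure ℝ≥0} {l : ℝ}

theorem integrable_coe_of_exp (hl : 0 < l)
    (hW : Integrable (fun w : ℝ≥0 => Real.exp (l * w)) W) :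
    Integrable (fun w : ℝ≥0 => (w : ℝ)) W := by
  refine (hW.div_const l).mono' (by fun_prop) (Filter.Eventually.of_forall fun w => ?_)
  rw [Real.norm_of_nonneg (NNReal.coe_nonneg w), le_div_iff₀ hl]
  have := Real.add_one_le_exp (l * w)
  linarith

/-- Half of the exponent is spent on w² ≤ (8/l²) exp(lw/2). -/
theorem integrable_sq_mul_exp (hl : 0 < l)
    (hW : Integrable (fun w : ℝ≥0 => Real.exp (l * w)) W) :
    Integrable (fun w : ℝ≥0 => (w : ℝ) ^ 2 * Real.exp (l / 2 * w)) W := by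
  refine (hW.const_mul (8 / l ^ 2)).mono' (by fun_prop) (Filter.Eventually.of_forall fun w => ?_)
  have hw : (0 : ℝ) ≤ w := w.2
  rw [Real.norm_of_nonneg (by positivity)]
  have h1 := Real.quadratic_le_exp_of_nonneg (x := l / 2 * w) (by positivity)
  have h2 : (w : ℝ) ^ 2 ≤ 8 / l ^ 2 * Real.exp (l / 2 * w) := by
    rw [div_mul_eq_mul_div, le_div_iff₀ (by positivity)]
    have : 0 ≤ l / 2 * w := by positivity
    nlinarith
  calc (w : ℝ) ^ 2 * Real.exp (l / 2 * w)
      ≤ 8 / l ^ 2 * Real.exp (l / 2 * w) * Real.exp (l / 2 * w) := by gcongr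
    _ = _ := by
      rw [mul_assoc, ← Real.exp_add]
      ring_nf

variable [IsProbabilityMeasure W]

/-- Integration of an affine bound in `w` and `w ^ 2 * exp (l / 2 * w)`. -/
theorem lintegral_ofReal_le_of_le (hl : 0 < l)
    (hW : Integrable (fun w : ℝ≥0 => Real.exp (l * w)) W) (hW1 : ∫ w : ℝ≥0, (w : ℝ) ∂W = 1)
    (f : ℝ≥0 → ℝ) (hf0 : ∀ w, 0 ≤ f w) (A₀ A₁ A₂ : ℝ)
    (hf : ∀ w : ℝ≥0, f w ≤ A₀ + A₁ * w + A₂ * (w ^ 2 * Real.exp (l / 2 * w))) :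
    0 ≤ A₀ + A₁ + A₂ * ∫ w : ℝ≥0, (w : ℝ) ^ 2 * Real.exp (l / 2 * w) ∂W ∧
    ∫⁻ w, ENNReal.ofReal (f w) ∂W ≤ ENNReal.ofReal
      (A₀ + A₁ + A₂ * ∫ w : ℝ≥0, (w : ℝ) ^ 2 * Real.exp (l / 2 * w) ∂W) := by
  have i1 := integrable_coe_of_exp hl hW
  have i2 := integrable_sq_mul_exp hl hW
  have hint : Integrable (fun w : ℝ≥0 =>
      A₀ + A₁ * w + A₂ * ((w : ℝ) ^ 2 * Real.exp (l / 2 * w))) W :=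
    ((integrable_const A₀).add (i1.const_mul A₁)).add (i2.const_mul A₂)
  have hval : ∫ w : ℝ≥0, (A₀ + A₁ * w + A₂ * ((w : ℝ) ^ 2 * Real.exp (l / 2 * w))) ∂W =
      A₀ + A₁ + A₂ * ∫ w : ℝ≥0, (w : ℝ) ^ 2 * Real.exp (l / 2 * w) ∂W := by
    have h01 : Integrable (fun w : ℝ≥0 => A₀ + A₁ * (w : ℝ)) W :=
      (integrable_const A₀).add (i1.const_mul A₁)
    rw [integral_add h01 (i2.const_mul A₂),
      integral_add (integrable_const A₀) (i1.const_mul A₁), integral_const_mul,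
      integral_const_mul, hW1]
    simp
  have hnn : ∀ w : ℝ≥0, 0 ≤ A₀ + A₁ * w + A₂ * ((w : ℝ) ^ 2 * Real.exp (l / 2 * w)) :=
    fun w => (hf0 w).trans (hf w)
  rw [← hval]
  refine ⟨integral_nonneg hnn, ?_⟩
  rw [ofReal_integral_eq_lintegral_ofReal hint (Filter.Eventually.of_forall hnn)]
  exact lintegral_mono fun w => ENNReal.ofReal_le_ofReal (hf w)

end Donations

/-! ### The two-choice algorithm as a Markov process on value vectors. -/

namespace Network

variable {V : Type u} [Fintype V] [PseudoMetricSpace V] (I : Network V)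

/-- The food bank that the two-choice algorithm takes in round `t` for a load from `u` to `v`,
if the individuals served by the food banks have received `x`. -/
noncomputable def select (tie : ℕ → I.banks → I.banks → Bool) (t : ℕ) (x : I.banks → ℝ)
    (u v : V) : I.banks :=
  if x (I.nearest u) < x (I.nearest v) then I.nearest u
  else if x (I.nearest v) < x (I.nearest u) then I.nearest v
  else if tie t (I.nearest u) (I.nearest v) then I.nearest u
  else I.nearest v

theorem select_eq_or (tie : ℕ → I.banks → I.banks → Bool) (t : ℕ) (x : I.banks → ℝ) (u v : V) :
    I.select tie t x u v = I.nearest u ∨ I.select tie t x u v = I.nearest v := by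
  unfold select
  split_ifs <;> simp

theorem select_le (tie : ℕ → I.banks → I.banks → Bool) (t : ℕ) (x : I.banks → ℝ) (u v : V) :
    x (I.select tie t x u v) ≤ x (I.nearest u) ∧ x (I.select tie t x u v) ≤ x (I.nearest v) := by
  unfold select
  split_ifs <;> constructor <;> linarith

theorem twoChoice_eq_or (tie : ℕ → I.banks → I.banks → Bool) (h : I.Transcript) (ℓ : Load V) :
    I.twoChoice tie h ℓ = I.nearest ℓ.1 ∨ I.twoChoice tie h ℓ = I.nearest ℓ.2.1 :=
  I.select_eq_or tie h.length (I.value h) ℓ.1 ℓ.2.1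

/-- If the bank g nearest to x is taken, then d(x,g) + d(g,y) ≤ 2d(x,g) + d(x,y) ≤ 3d(x,f') +
d(f',y); the other endpoint is symmetric. -/
theorem driverEfficient_twoChoice (tie : ℕ → I.banks → I.banks → Bool) :
    I.DriverEfficient 3 (I.twoChoice tie) := by
  intro ω t f'
  have h1 := I.nearest_le (ω t).1 f'
  have h2 := I.nearest_le (ω t).2.1 f'
  rcases I.twoChoice_eq_or tie (I.transcript (I.twoChoice tie) ω t) (ω t) with h | h <;> rw [h]
  · have h3 := dist_triangle (I.nearest (ω t).1 : V) (ω t).1 (ω t).2.1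
    have h4 := dist_triangle (ω t).1 (f' : V) (ω t).2.1
    rw [dist_comm (I.nearest (ω t).1 : V) (ω t).1] at h3
    have := dist_nonneg (x := (f' : V)) (y := (ω t).2.1)
    linarith
  · have h3 := dist_triangle (ω t).1 (ω t).2.1 (I.nearest (ω t).2.1 : V)
    have h4 := dist_triangle (ω t).1 (f' : V) (ω t).2.1
    rw [dist_comm (I.nearest (ω t).2.1 : V) (ω t).2.1]
    rw [dist_comm (f' : V) (ω t).2.1] at *
    have := dist_nonneg (x := (ω t).1) (y := (f' : V))
    linarith

theorem length_transcript (A : I.Algorithm) (ω : ℕ → Load V) (t : ℕ) :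
    (I.transcript A ω t).length = t := by
  induction t with
  | zero => rfl
  | succ t ih => simp [transcript, ih]

theorem value_cons (ℓ : Load V) (f : I.banks) (h : I.Transcript) :
    I.value ((ℓ, f) :: h) = receive I.served (I.value h) f ℓ.2.2 := by
  classical
  funext i
  simp only [value, receive, received, List.map_cons, List.sum_cons]
  rw [add_div, add_comm]
  congr!

theorem value_nonneg (h : I.Transcript) (f : I.banks) : 0 ≤ I.value h f := by
  classical
  refine div_nonneg (List.sum_nonneg ?_) (Nat.cast_nonneg _)
  intro y hy
  obtain ⟨e, -, rfl⟩ := List.mem_map.1 hy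
  split_ifs
  · exact NNReal.coe_nonneg _
  · exact le_rfl

theorem EnvyFree.mono {γ γ' : ℝ} (hγ : γ ≤ γ') {h : I.Transcript} (hE : I.EnvyFree γ h) :
    I.EnvyFree γ' h := fun f f' hf hf' =>
  (hE f f' hf hf').trans (mul_le_mul_of_nonneg_right hγ (I.value_nonneg h f))

theorem sum_served : ∑ f, I.served f = I.total := by
  classical
  exact Finset.sum_fiberwise Finset.univ I.nearest I.pop

/-- The values after a load, as a function of the values before it and of the load. -/
noncomputable def next (tie : ℕ → I.banks → I.banks → Bool) (t : ℕ)
    (y : (I.banks → ℝ) × Load V) : I.banks → ℝ :=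
  receive I.served y.1 (I.select tie t y.1 y.2.1 y.2.2.1) y.2.2.2

/-- The values after `t` rounds. -/
noncomputable def valueAt (tie : ℕ → I.banks → I.banks → Bool) (t : ℕ) (ω : ℕ → Load V) :
    I.banks → ℝ :=
  I.value (I.transcript (I.twoChoice tie) ω t)

theorem valueAt_zero (tie : ℕ → I.banks → I.banks → Bool) (ω : ℕ → Load V) :
    I.valueAt tie 0 ω = 0 := by
  funext f
  simp [valueAt, transcript, value, received]

theorem valueAt_succ (tie : ℕ → I.banks → I.banks → Bool) (t : ℕ) (ω : ℕ → Load V) :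
    I.valueAt tie (t + 1) ω = I.next tie t (I.valueAt tie t ω, ω t) := by
  have h : I.twoChoice tie (I.transcript (I.twoChoice tie) ω t) (ω t) =
      I.select tie (I.transcript (I.twoChoice tie) ω t).length (I.valueAt tie t ω)
        (ω t).1 (ω t).2.1 := rfl
  rw [length_transcript] at h
  unfold next
  rw [valueAt, transcript, value_cons, h]
  rfl

variable [MeasurableSpace V] [DiscreteMeasurableSpace V]

theorem measurable_next (tie : ℕ → I.banks → I.banks → Bool) (t : ℕ) :
    Measurable (I.next tie t) := by
  classical
  refine measurable_pi_lambda _ fun f => ?_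
  have hsel : ∀ u v, MeasurableSet {x : I.banks → ℝ | I.select tie t x u v = f} := by
    intro u v
    have hlt : ∀ i j : I.banks, MeasurableSet {x : I.banks → ℝ | x i < x j} := fun i j =>
      measurableSet_lt (measurable_pi_apply i) (measurable_pi_apply j)
    have : Measurable fun x : I.banks → ℝ => I.select tie t x u v := by
      unfold select
      exact Measurable.ite (hlt _ _) measurable_const
        (Measurable.ite (hlt _ _) measurable_const measurable_const)
    exact this (measurableSet_singleton f)
  have hset : MeasurableSet {y : (I.banks → ℝ) × Load V |
      I.select tie t y.1 y.2.1 y.2.2.1 = f} := by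
    have : {y : (I.banks → ℝ) × Load V | I.select tie t y.1 y.2.1 y.2.2.1 = f} =
        ⋃ u, ⋃ v, ((fun y => y.2.1) ⁻¹' {u}) ∩ ((fun y => y.2.2.1) ⁻¹' {v}) ∩
          ((fun y => y.1) ⁻¹' {x | I.select tie t x u v = f}) := by
      ext y
      simp
    rw [this]
    refine MeasurableSet.iUnion fun u => MeasurableSet.iUnion fun v => ?_
    refine (MeasurableSet.inter ?_ ?_).inter (measurable_fst (hsel u v))
    · exact (measurable_fst.comp measurable_snd) (measurableSet_singleton u)
    · exact (measurable_fst.comp (measurable_snd.comp measurable_snd)) (measurableSet_singleton v)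
  unfold next receive
  refine ((measurable_pi_apply f).comp measurable_fst).add (Measurable.div_const ?_ _)
  exact Measurable.ite hset (by fun_prop) measurable_const

theorem measurable_valueAt (tie : ℕ → I.banks → I.banks → Bool) (t : ℕ) :
    Measurable (I.valueAt tie t) := by
  induction t with
  | zero =>
    have : I.valueAt tie 0 = fun _ => 0 := funext fun ω => I.valueAt_zero tie ω
    rw [this]
    exact measurable_const
  | succ t ih =>
    have : I.valueAt tie (t + 1) = fun ω => I.next tie t (I.valueAt tie t ω, ω t) :=
      funext fun ω => I.valueAt_succ tie t ω
    rw [this]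
    exact (I.measurable_next tie t).comp (ih.prodMk (measurable_pi_apply t))

theorem lintegral_valueAt_succ_le (tie : ℕ → I.banks → I.banks → Bool) (D : Measure V)
    [IsProbabilityMeasure D] (W : Measure ℝ≥0) [IsProbabilityMeasure W]
    (g : (I.banks → ℝ) → ENNReal) (hg : Measurable g) (ρ κ : ENNReal) (t : ℕ)
    (h : ∀ x, ∫⁻ ℓ, g (I.next tie t (x, ℓ)) ∂(D.prod (D.prod W)) ≤ ρ * g x + κ) :
    ∫⁻ ω, g (I.valueAt tie (t + 1) ω) ∂(loadLaw D W) ≤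
      ρ * ∫⁻ ω, g (I.valueAt tie t ω) ∂(loadLaw D W) + κ := by
  have : IsProbabilityMeasure (loadLaw D W) := by
    unfold loadLaw
    infer_instance
  have e : ∫⁻ ω, g (I.valueAt tie (t + 1) ω) ∂(loadLaw D W) = _ :=
    lintegral_process_succ (D.prod (D.prod W)) (I.next tie)
    (I.measurable_next tie) (I.valueAt tie) 0 (I.valueAt_zero tie) (I.valueAt_succ tie)
    (I.measurable_valueAt tie) g hg t
  rw [e]
  change ∫⁻ ω, _ ∂(loadLaw D W) ≤ _
  refine (lintegral_mono fun ω => h (I.valueAt tie t ω)).trans_eq ?_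
  have hm : Measurable fun ω => g (I.valueAt tie t ω) := hg.comp (I.measurable_valueAt tie t)
  rw [lintegral_add_right _ measurable_const, lintegral_const_mul _ hm, lintegral_const,
    measure_univ, mul_one]

end Network
-- From the potential to envy.
theorem measurable_potential {ι : Type*} [Fintype ι] (n : ι → ℕ) (a : ℝ) :
    Measurable (potential n a) := by
  unfold potential average
  refine Finset.measurable_sum _ fun i _ => (Real.measurable_cosh.comp ?_).const_mul _
  refine ((measurable_pi_apply i).sub (Measurable.div_const ?_ _)).const_mul _
  exact Finset.measurable_sum _ fun j _ => (measurable_pi_apply j).const_mul _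

theorem potential_nonneg {ι : Type*} [Fintype ι] (n : ι → ℕ) (a : ℝ) (x : ι → ℝ) :
    0 ≤ potential n a x :=
  Finset.sum_nonneg fun _ _ => mul_nonneg (Nat.cast_nonneg _) (Real.cosh_pos _).le

theorem potential_zero {ι : Type*} [Fintype ι] (n : ι → ℕ) (a : ℝ) :
    potential n a 0 = ∑ i, (n i : ℝ) := by
  simp [potential, average]

/-- A bound on the potential bounds the distance of every value from the average. -/
theorem mul_abs_sub_average_le {ι : Type*} [Fintype ι] (n : ι → ℕ) {a : ℝ} (ha : 0 ≤ a)
    (x : ι → ℝ) {B : ℝ} (hB : potential n a x ≤ B) {i : ι} (hi : 0 < n i) :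
    a * |x i - average n x| ≤ Real.log (2 * B) := by
  have h1 : Real.cosh (a * (x i - average n x)) ≤ B := by
    refine le_trans ?_ (le_trans (Finset.single_le_sum
      (f := fun i => n i * Real.cosh (a * (x i - average n x))) (fun j _ =>
        mul_nonneg (Nat.cast_nonneg _) (Real.cosh_pos _).le) (Finset.mem_univ i)) hB)
    exact le_mul_of_one_le_left (Real.cosh_pos _).le (by exact_mod_cast hi)
  have h2 : Real.exp |a * (x i - average n x)| ≤ 2 * B := by
    have := Real.cosh_abs (a * (x i - average n x))
    rw [Real.cosh_eq] at this
    have := Real.exp_pos (-|a * (x i - average n x)|)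
    linarith
  rw [← abs_of_nonneg ha, ← abs_mul]
  rw [Real.le_log_iff_exp_le ((Real.exp_pos _).trans_le h2)]
  exact h2

namespace Network

variable {V : Type u} [Fintype V] [PseudoMetricSpace V] (I : Network V)

theorem sum_served_cast : ∑ f, (I.served f : ℝ) = I.total := by
  rw [← I.sum_served]
  push_cast
  rfl

/-- If the potential is polynomial in `N` and the total value is large, nobody envies. -/
theorem envyFree_of_potential_le (h : I.Transcript) {a k C : ℝ} (ha : 0 < a) (hk : 0 < k)
    (hN : 2 ≤ I.total) {m : ℕ} (hC : 8 * ((4 + k) / a) ≤ C)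
    (hm : C * (I.total * Real.log I.total) ≤ m)
    (hpot : potential I.served a (I.value h) ≤ 4 * I.total * (I.total : ℝ) ^ k)
    (hsum : (m : ℝ) / 2 ≤ ∑ f, I.served f * I.value h f) :
    I.EnvyFree (1 + C * ((I.total * Real.log I.total) / m)) h := by
  have hN2 : (2 : ℝ) ≤ I.total := by exact_mod_cast hN
  set N : ℝ := (Nat.cast I.total) with hNdef
  have hN0 : 0 < N := by linarith
  set L := Real.log N with hL
  have hlog2 : Real.log 2 ≤ L := Real.log_le_log (by norm_num) hN2
  have hL0 : 0 < L := (Real.log_pos (by norm_num)).trans_le hlog2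
  set G := (4 + k) / a with hG
  have hG0 : 0 < G := by positivity
  have hC0 : 0 < C := by linarith
  have hm0 : (0 : ℝ) < m := lt_of_lt_of_le (by positivity) hm
  set μ := average I.served (I.value h) with hμ
  have hμm : m / (2 * N) ≤ μ := by
    rw [hμ, average, I.sum_served_cast, ← hNdef, div_le_div_iff₀ (by positivity) hN0]
    nlinarith
  have hgap : ∀ f, 0 < I.served f → |I.value h f - μ| ≤ G * L := by
    intro f hf
    have h1 := mul_abs_sub_average_le I.served ha.le (I.value h) hpot hf
    -- Since N ≥ 2, 8 N^(1+k) ≤ N^(4+k); this is where 4 + k comes from.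
    have h2 : Real.log (2 * (4 * N * N ^ k)) ≤ (4 + k) * L := by
      have e : 2 * (4 * N * N ^ k) = 2 ^ 3 * (N * N ^ k) := by ring
      rw [e, Real.log_mul (by positivity) (by positivity), Real.log_pow,
        Real.log_mul (by positivity) (by positivity), Real.log_rpow hN0]
      push_cast
      nlinarith
    rw [hG, div_mul_eq_mul_div, le_div_iff₀ ha]
    linarith
  -- The gap is at most a quarter of the lower bound for the average, so each value is at least
  -- m/(4N). Two gaps of size G log N are then a fraction 8G·(N log N)/m of it.
  have hGm : 4 * (G * L) ≤ m / (2 * N) := by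
    rw [le_div_iff₀ (by positivity)]
    have : 8 * G * (N * L) ≤ m := le_trans (by gcongr) hm
    linarith
  intro f f' hf hf'
  have h1 := abs_le.1 (hgap f hf)
  have h2 := abs_le.1 (hgap f' hf')
  have h3 : m / (4 * N) ≤ I.value h f := by
    have : (m : ℝ) / (4 * N) = m / (2 * N) / 2 := by
      field_simp
      norm_num
    have : 0 ≤ G * L := by positivity
    linarith
  have h4 : 2 * (G * L) ≤ C * (N * L / m) * I.value h f := by
    calc 2 * (G * L) = 8 * G * (N * L / m) * (m / (4 * N)) := by
          field_simp
          norm_num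
      _ ≤ C * (N * L / m) * I.value h f := by gcongr
  linarith

variable [MeasurableSpace V] (D : Measure V) [IsProbabilityMeasure D]

variable {D} {I}

/-- The upper bias bound gives mass zero to the region of a bank serving nobody. -/
theorem Biased.served_ne_zero {α β : ℝ} (hD : I.Biased α β D) {u : V} (hu : D.real {u} ≠ 0) :
    I.served (I.nearest u) ≠ 0 := by
  intro h
  have h1 := (hD (I.nearest u)).2
  rw [h, Nat.cast_zero, mul_zero, zero_div] at h1
  have h2 : D.real {u} ≤ D.real {v | I.nearest v = I.nearest u} :=
    measureReal_mono (by simp)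
  exact hu (le_antisymm (h2.trans h1) measureReal_nonneg)

theorem Biased.served_select_ne_zero {α β : ℝ} (hD : I.Biased α β D)
    (tie : ℕ → I.banks → I.banks → Bool) (t : ℕ) (x : I.banks → ℝ) {u v : V}
    (huv : D.real {u} * D.real {v} ≠ 0) : I.served (I.select tie t x u v) ≠ 0 := by
  rcases I.select_eq_or tie t x u v with h | h <;> rw [h]
  · exact hD.served_ne_zero (left_ne_zero_of_mul huv)
  · exact hD.served_ne_zero (right_ne_zero_of_mul huv)

variable [DiscreteMeasurableSpace V]

variable (I D) in
theorem fibreMass_nearest (f : I.banks) :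
    fibreMass (fun u => D.real {u}) I.nearest f = D.real {v | I.nearest v = f} := by
  classical
  have := sum_measureReal_singleton (μ := D) (Finset.univ.filter fun v => I.nearest v = f)
  simp only [Finset.coe_filter, Finset.mem_univ, true_and] at this
  rw [← this, Finset.sum_filter]
  unfold fibreMass
  refine Finset.sum_congr rfl fun u _ => ?_
  split_ifs <;> simp

variable (D) in
theorem sum_real_singleton : ∑ u, D.real {u} = 1 := by
  rw [sum_measureReal_singleton]
  simp

variable {W : Measure ℝ≥0} [IsProbabilityMeasure W] {l : ℝ}

theorem Biased.lintegral_potential_next_le {α β : ℝ} (hα : 1 ≤ α) (hβ : 1 ≤ β)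
    (hαβ : β * (α - 1) < 1) (hD : I.Biased α β D) (hN : 0 < I.total) (hl : 0 < l)
    (hW : Integrable (fun w : ℝ≥0 => Real.exp (l * w)) W) (hW1 : ∫ w : ℝ≥0, (w : ℝ) ∂W = 1)
    {a : ℝ} (ha : 0 < a) (hal : a ≤ l / 2)
    (haS : a * ((∫ w : ℝ≥0, (w : ℝ) ^ 2 * Real.exp (l / 2 * w) ∂W) * (2 * β + 1)) ≤
      (1 + 1 / β - α) / α ^ 2 / 12)
    (tie : ℕ → I.banks → I.banks → Bool) (t : ℕ) (x : I.banks → ℝ) :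
    ∫⁻ ℓ, ENNReal.ofReal (potential I.served a (I.next tie t (x, ℓ))) ∂(D.prod (D.prod W)) ≤
      ENNReal.ofReal ((1 - a * ((1 + 1 / β - α) / α ^ 2) / (12 * I.total)) *
        potential I.served a x + a * ((1 + 1 / β - α) / α ^ 2) / 6) := by
  set S := ∫ w : ℝ≥0, (w : ℝ) ^ 2 * Real.exp (l / 2 * w) ∂W with hS
  have hS0 : 0 ≤ S := integral_nonneg fun w => by positivity
  have hm : Measurable fun ℓ : Load V =>
      ENNReal.ofReal (potential I.served a (I.next tie t (x, ℓ))) :=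
    ENNReal.measurable_ofReal.comp ((measurable_potential _ _).comp
      ((I.measurable_next tie t).comp measurable_prodMk_left))
  refine (lintegral_load_le D W _ hm _ fun u v huv => ?_).trans
    (ENNReal.ofReal_le_ofReal ((sum_drift_le (x := x) (n := I.served) (b := I.nearest)
      (ch := I.select tie t x) hα hβ hαβ
      (fun u => measureReal_nonneg) (sum_real_singleton D) (I.select_eq_or tie t x)
      (I.select_le tie t x) ?_ ?_ ?_ ha hS0 haS).trans_eq ?_))
  · have hj := hD.served_select_ne_zero tie t x huv
    have := lintegral_ofReal_le_of_le hl hW hW1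
      (fun w => potential I.served a (receive I.served x (I.select tie t x u v) w))
      (fun w => potential_nonneg _ _ _) (potential I.served a x)
      (a * potentialSlope I.served a x (I.select tie t x u v))
      (a ^ 2 * potentialCurvature I.served a x (I.select tie t x u v)) fun w => ?_
    · rw [mul_right_comm] at this
      exact this
    · refine (potential_receive_le I.served x hj ha.le (NNReal.coe_nonneg w)).trans ?_
      have h0 := potentialCurvature_nonneg I.served a x (I.select tie t x u v)
      have h1 : (w : ℝ) ^ 2 * Real.exp (a * w) ≤ (w : ℝ) ^ 2 * Real.exp (l / 2 * w) := by
        gcongr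
      have h2 := mul_le_mul_of_nonneg_left h1 (mul_nonneg (sq_nonneg a) h0)
      linarith
  · rw [I.sum_served_cast]
    exact_mod_cast hN
  · intro f
    rw [I.sum_served_cast, I.fibreMass_nearest D]
    exact (hD f).1
  · intro f
    rw [I.sum_served_cast, I.fibreMass_nearest D]
    exact (hD f).2
  · rw [I.sum_served_cast]

/-- The expected potential stays linear in the population. -/
theorem Biased.lintegral_potential_le {α β : ℝ} (hα : 1 ≤ α) (hβ : 1 ≤ β)
    (hαβ : β * (α - 1) < 1) (hD : I.Biased α β D) (hN : 0 < I.total) (hl : 0 < l)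
    (hW : Integrable (fun w : ℝ≥0 => Real.exp (l * w)) W) (hW1 : ∫ w : ℝ≥0, (w : ℝ) ∂W = 1)
    {a : ℝ} (ha : 0 < a) (ha1 : a ≤ 1) (hal : a ≤ l / 2)
    (haS : a * ((∫ w : ℝ≥0, (w : ℝ) ^ 2 * Real.exp (l / 2 * w) ∂W) * (2 * β + 1)) ≤
      (1 + 1 / β - α) / α ^ 2 / 12)
    (tie : ℕ → I.banks → I.banks → Bool) (t : ℕ) :
    ∫⁻ ω, ENNReal.ofReal (potential I.served a (I.valueAt tie t ω)) ∂(loadLaw D W) ≤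
      ENNReal.ofReal (2 * I.total) := by
  have hN1 : (1 : ℝ) ≤ I.total := by exact_mod_cast hN
  set c := (1 + 1 / β - α) / α ^ 2 with hc
  have hc1 : c ≤ 1 := by
    rw [hc, div_le_one (by positivity)]
    have : 1 / β ≤ 1 := by
      rw [div_le_one (by linarith)]
      exact hβ
    nlinarith
  have hc0 : 0 ≤ c := by
    have : α - 1 ≤ 1 / β := by
      rw [le_div_iff₀ (by linarith)]
      linarith
    exact div_nonneg (by linarith) (by positivity)
  have hac : a * c ≤ 1 := mul_le_one₀ ha1 hc0 hc1
  have hρ : 0 ≤ 1 - a * c / (12 * I.total) := by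
    rw [sub_nonneg, div_le_one (by positivity)]
    linarith
  induction t with
  | zero =>
    have : IsProbabilityMeasure (loadLaw D W) := by
      unfold loadLaw
      infer_instance
    simp only [I.valueAt_zero, potential_zero, I.sum_served_cast, lintegral_const, measure_univ,
      mul_one]
    exact ENNReal.ofReal_le_ofReal (by linarith)
  | succ t ih =>
    refine (I.lintegral_valueAt_succ_le tie D W
      (fun x => ENNReal.ofReal (potential I.served a x))
      (ENNReal.measurable_ofReal.comp (measurable_potential _ _))
      (ENNReal.ofReal (1 - a * c / (12 * I.total))) (ENNReal.ofReal (a * c / 6)) t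
      fun x => ?_).trans ?_
    · rw [← ENNReal.ofReal_mul hρ, ← ENNReal.ofReal_add (mul_nonneg hρ (potential_nonneg _ _ _))
        (by positivity)]
      exact hD.lintegral_potential_next_le hα hβ hαβ hN hl hW hW1 ha hal haS tie t x
    -- 2N is the fixed point of the recursion: the contraction removes exactly ac/6.
    · calc _ ≤ ENNReal.ofReal (1 - a * c / (12 * I.total)) * ENNReal.ofReal (2 * I.total) +
            ENNReal.ofReal (a * c / 6) := by gcongr
        _ = ENNReal.ofReal (2 * I.total) := by
          rw [← ENNReal.ofReal_mul hρ, ← ENNReal.ofReal_add (by positivity) (by positivity)]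
          congr 1
          field_simp
          ring

/-- The exponential moment behind the lower tail of the total donated value. -/
theorem Biased.lintegral_exp_neg_total_le {α β : ℝ} (hD : I.Biased α β D) (hl : 0 < l)
    (hW : Integrable (fun w : ℝ≥0 => Real.exp (l * w)) W) (hW1 : ∫ w : ℝ≥0, (w : ℝ) ∂W = 1)
    {s : ℝ} (hs : 0 < s) (hsl : s ≤ l / 2)
    (hsS : s * ∫ w : ℝ≥0, (w : ℝ) ^ 2 * Real.exp (l / 2 * w) ∂W ≤ 1 / 4)
    (tie : ℕ → I.banks → I.banks → Bool) (t : ℕ) :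
    ∫⁻ ω, ENNReal.ofReal (Real.exp (-(s * ∑ f, I.served f * I.valueAt tie t ω f)))
      ∂(loadLaw D W) ≤ ENNReal.ofReal (Real.exp (-(3 / 4 * s * t))) := by
  set S := ∫ w : ℝ≥0, (w : ℝ) ^ 2 * Real.exp (l / 2 * w) ∂W with hS
  have hg : Measurable fun x : I.banks → ℝ =>
      ENNReal.ofReal (Real.exp (-(s * ∑ f, I.served f * x f))) := by
    fun_prop
  induction t with
  | zero =>
    have : IsProbabilityMeasure (loadLaw D W) := by
      unfold loadLaw
      infer_instance
    simp [I.valueAt_zero]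
  | succ t ih =>
    refine (I.lintegral_valueAt_succ_le tie D W _ hg
      (ENNReal.ofReal (Real.exp (-(3 / 4 * s)))) 0 t fun x => ?_).trans ?_
    · rw [add_zero, ← ENNReal.ofReal_mul (Real.exp_pos _).le]
      have hm : Measurable fun ℓ : Load V => ENNReal.ofReal
          (Real.exp (-(s * ∑ f, I.served f * I.next tie t (x, ℓ) f))) :=
        hg.comp ((I.measurable_next tie t).comp measurable_prodMk_left)
      refine (lintegral_load_le D W _ hm (fun _ _ => Real.exp (-(3 / 4 * s)) *
        Real.exp (-(s * ∑ f, I.served f * x f))) fun u v huv => ⟨by positivity, ?_⟩).trans_eq ?_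
      · have hj := hD.served_select_ne_zero tie t x huv
        set E := Real.exp (-(s * ∑ f, I.served f * x f)) with hE
        have hE0 : 0 < E := Real.exp_pos _
        have := (lintegral_ofReal_le_of_le hl hW hW1
          (fun w => Real.exp (-(s * ∑ f, I.served f * I.next tie t (x, (u, v, w)) f)))
          (fun w => (Real.exp_pos _).le) E (-(E * s)) (E * s ^ 2) fun w => ?_).2
        · refine this.trans (ENNReal.ofReal_le_ofReal ?_)
          have h1 := Real.add_one_le_exp (-(3 / 4 * s))
          -- `hsS` gives s²S ≤ s/4, which turns the mean 1 into the rate 3/4.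
          have h2 : 1 - s + s ^ 2 * S ≤ Real.exp (-(3 / 4 * s)) := by nlinarith
          calc E + -(E * s) + E * s ^ 2 * S = (1 - s + s ^ 2 * S) * E := by ring
            _ ≤ _ := mul_le_mul_of_nonneg_right h2 hE0.le
        · have h0 : ∑ f, I.served f * I.next tie t (x, (u, v, w)) f =
              ∑ f, I.served f * x f + w := sum_mul_receive I.served x hj w
          have hw : (0 : ℝ) ≤ w := w.2
          have h1 := exp_le_one_add_add_sq (-(s * w))
          rw [abs_neg, abs_of_nonneg (by positivity), neg_sq] at h1
          have h2 : Real.exp (s * w) ≤ Real.exp (l / 2 * w) := by gcongr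
          have h3 : (s * w) ^ 2 * Real.exp (s * w) ≤ (s * w) ^ 2 * Real.exp (l / 2 * w) := by
            gcongr
          rw [h0, mul_add, neg_add, Real.exp_add, ← hE]
          calc E * Real.exp (-(s * w)) ≤ E * (1 + -(s * w) +
                (s * w) ^ 2 * Real.exp (l / 2 * w)) :=
              mul_le_mul_of_nonneg_left (by linarith) hE0.le
            _ = _ := by ring
      · congr 1
        simp only [← Finset.sum_mul, ← Finset.mul_sum, sum_real_singleton, one_mul]
    · rw [add_zero]
      refine (mul_le_mul_right ih _).trans_eq ?_
      rw [← ENNReal.ofReal_mul (Real.exp_pos _).le, ← Real.exp_add]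
      congr 2
      push_cast
      ring

end Network

/-! ### The high-probability bound. -/

theorem envyFree_core {α β : ℝ} (hα : 1 ≤ α) (hβ : 1 ≤ β) (hαβ : β * (α - 1) < 1)
    (W : Measure ℝ≥0) [IsProbabilityMeasure W] {l : ℝ} (hl : 0 < l)
    (hW : Integrable (fun w : ℝ≥0 => Real.exp (l * w)) W) (hW1 : ∫ w : ℝ≥0, (w : ℝ) ∂W = 1)
    {k : ℝ} (hk : 0 < k) :
    ∃ C : ℝ, 1 < C ∧ ∀ (V : Type u) [Fintype V] [PseudoMetricSpace V] [MeasurableSpace V]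
      [DiscreteMeasurableSpace V] (I : Network V) (tie : ℕ → I.banks → I.banks → Bool)
      (D : Measure V) [IsProbabilityMeasure D], I.Biased α β D →
      ∀ m : ℕ, C * (I.total * Real.log I.total) ≤ m →
        1 - (I.total : ℝ) ^ (-k) ≤ (loadLaw D W).real
          {ω | I.EnvyFree (1 + C * ((I.total * Real.log I.total) / m))
            (I.transcript (I.twoChoice tie) ω m)} := by
  set S := ∫ w : ℝ≥0, (w : ℝ) ^ 2 * Real.exp (l / 2 * w) ∂W with hS
  have hS0 : 0 ≤ S := integral_nonneg fun w => by positivity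
  set c := (1 + 1 / β - α) / α ^ 2 with hc
  have hc0 : 0 < c := by
    have : α - 1 < 1 / β := by
      rw [lt_div_iff₀ (by linarith)]
      linarith
    exact div_pos (by linarith) (by positivity)
  -- S + 1 replaces S to keep the denominators positive without a lower bound on S.
  set a := min (min 1 (l / 2)) (c / 12 / ((S + 1) * (2 * β + 1))) with ha
  have ha0 : 0 < a := by positivity
  have ha1 : a ≤ 1 := (min_le_left _ _).trans (min_le_left _ _)
  have hal : a ≤ l / 2 := (min_le_left _ _).trans (min_le_right _ _)
  have haS : a * (S * (2 * β + 1)) ≤ c / 12 := by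
    have h1 : a ≤ c / 12 / ((S + 1) * (2 * β + 1)) := min_le_right _ _
    rw [le_div_iff₀ (by positivity)] at h1
    refine le_trans ?_ h1
    gcongr
    linarith
  set s := min (l / 2) (1 / 4 / (S + 1)) with hs
  have hs0 : 0 < s := by positivity
  have hsl : s ≤ l / 2 := min_le_left _ _
  have hsS : s * S ≤ 1 / 4 := by
    have h1 : s ≤ 1 / 4 / (S + 1) := min_le_right _ _
    rw [le_div_iff₀ (by positivity)] at h1
    nlinarith
  -- The entries ensure C > 1, the envy estimate, and the tail bound for the total value.
  set C := max 2 (max (8 * ((4 + k) / a)) (4 * (k + 1) / s)) with hC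
  have hC2 : 2 ≤ C := le_max_left _ _
  have hCa : 8 * ((4 + k) / a) ≤ C := (le_max_left _ _).trans (le_max_right _ _)
  have hCs : 4 * (k + 1) / s ≤ C := (le_max_right _ _).trans (le_max_right _ _)
  refine ⟨C, by linarith, fun V _ _ _ _ I tie D _ hD m hm => ?_⟩
  have hprob : IsProbabilityMeasure (loadLaw D W) := by
    unfold loadLaw
    infer_instance
  rcases Nat.lt_or_ge I.total 2 with hN | hN
  · obtain h0 | h1 : I.total = 0 ∨ I.total = 1 := by omega
    · have hserved : ∀ f, I.served f = 0 := by
        have := I.sum_served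
        rw [h0, Finset.sum_eq_zero_iff] at this
        exact fun f => this f (Finset.mem_univ f)
      have : {ω | I.EnvyFree (1 + C * ((I.total * Real.log I.total) / m))
            (I.transcript (I.twoChoice tie) ω m)} = Set.univ := by
        ext ω
        simp [Network.EnvyFree, hserved]
      -- Here `0 ^ (-k) = 0`, so the claim asks for probability one; it holds because no bank serves
      -- anybody.
      rw [this, probReal_univ, h0, Nat.cast_zero, Real.zero_rpow (by linarith)]
      simp
    · rw [h1]
      simp
  have hN2 : (2 : ℝ) ≤ I.total := by exact_mod_cast hN
  set N : ℝ := (Nat.cast I.total) with hNdef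
  have hN0 : 0 < N := by linarith
  have hNk : 0 < N ^ (-k) := Real.rpow_pos_of_pos hN0 _
  set B := 4 * N * N ^ k with hB
  have hB0 : 0 < B := by positivity
  set bad₁ : Set (ℕ → Load V) :=
    {ω | ENNReal.ofReal B ≤ ENNReal.ofReal (potential I.served a (I.valueAt tie m ω))} with hbad₁
  set bad₂ : Set (ℕ → Load V) := {ω | ENNReal.ofReal (Real.exp (-(s * (m / 2)))) ≤
    ENNReal.ofReal (Real.exp (-(s * ∑ f, I.served f * I.valueAt tie m ω f)))} with hbad₂
  have hmark : ∀ (g : (ℕ → Load V) → ℝ) (_ : Measurable g) (y z : ℝ), 0 < y → 0 ≤ z →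
      ∫⁻ ω, ENNReal.ofReal (g ω) ∂(loadLaw D W) ≤ ENNReal.ofReal z →
      (loadLaw D W).real {ω | ENNReal.ofReal y ≤ ENNReal.ofReal (g ω)} ≤ z / y := by
    intro g hg y z hy hz h
    refine ENNReal.toReal_le_of_le_ofReal (by positivity) ?_
    refine (meas_ge_le_lintegral_div (ENNReal.measurable_ofReal.comp hg).aemeasurable
      (by simpa using hy) ENNReal.ofReal_ne_top).trans ?_
    rw [ENNReal.ofReal_div_of_pos hy]
    exact ENNReal.div_le_div_right h _
  have hvm := I.measurable_valueAt tie m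
  have h1 : (loadLaw D W).real bad₁ ≤ N ^ (-k) / 2 := by
    refine (hmark _ ((measurable_potential _ _).comp hvm) B (2 * N) hB0 (by positivity)
      (hD.lintegral_potential_le hα hβ hαβ (by omega) hl hW hW1 ha0 ha1 hal haS tie m)).trans_eq ?_
    rw [Real.rpow_neg hN0.le, hB]
    field_simp
    norm_num
  have h2 : (loadLaw D W).real bad₂ ≤ N ^ (-k) / 2 := by
    refine (hmark (fun ω => Real.exp (-(s * ∑ f, I.served f * I.valueAt tie m ω f)))
      (by fun_prop) _ _ (Real.exp_pos _) (Real.exp_pos _).le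
      (hD.lintegral_exp_neg_total_le hl hW hW1 hs0 hsl hsS tie m)).trans ?_
    rw [← Real.exp_sub]
    have hL0 : 0 ≤ Real.log N := Real.log_nonneg (by linarith)
    -- The threshold m/2 lies below the rate 3/4 and leaves exp(-sm/4) ≤ N^(-k-1); the spare factor
    -- 1/N is at most 1/2.
    have h3 : 4 * (k + 1) * Real.log N ≤ s * m := by
      rw [div_le_iff₀ hs0] at hCs
      calc 4 * (k + 1) * Real.log N ≤ C * s * Real.log N := by gcongr
        _ ≤ C * s * (N * Real.log N) := by
          gcongr
          nlinarith
        _ = s * (C * (N * Real.log N)) := by ring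
        _ ≤ s * m := by gcongr
    calc _ ≤ Real.exp (-(k + 1) * Real.log N) := by
          refine Real.exp_le_exp.2 ?_
          linarith
      _ = N ^ (-k) / N := by
          rw [mul_comm, ← Real.rpow_def_of_pos hN0, neg_add, Real.rpow_add hN0,
            Real.rpow_neg_one]
          rfl
      _ ≤ N ^ (-k) / 2 := by gcongr
  -- Covering the whole space and using subadditivity avoids measurability of the envy-free event.
  have hcover : Set.univ ⊆ {ω | I.EnvyFree (1 + C * ((N * Real.log N) / m))
      (I.transcript (I.twoChoice tie) ω m)} ∪ (bad₁ ∪ bad₂) := by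
    intro ω _
    by_contra hω
    simp only [Set.mem_union, not_or, hbad₁, hbad₂, Set.mem_ofPred_eq, not_le] at hω
    obtain ⟨hE, hω1, hω2⟩ := hω
    refine hE (I.envyFree_of_potential_le _ ha0 hk hN hCa hm ?_ ?_)
    · exact ((ENNReal.ofReal_lt_ofReal_iff hB0).1 hω1).le
    · have := (ENNReal.ofReal_lt_ofReal_iff (Real.exp_pos _)).1 hω2
      rw [Real.exp_lt_exp, neg_lt_neg_iff] at this
      exact (lt_of_mul_lt_mul_left this hs0.le).le
  have h3 := measureReal_mono (μ := loadLaw D W) hcover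
  rw [probReal_univ] at h3
  have h4 := measureReal_union_le (μ := loadLaw D W)
    {ω | I.EnvyFree (1 + C * ((N * Real.log N) / m))
      (I.transcript (I.twoChoice tie) ω m)} (bad₁ ∪ bad₂)
  have h5 := measureReal_union_le (μ := loadLaw D W) bad₁ bad₂
  linarith

/-! ### Reducing the assumptions on α, β and m. -/

theorem mul_sub_one_lt_one_of_log {α β : ℝ} (hα : 1 < α) (hβ : 1 < β)
    (h : 2 * Real.log ((α * β - 1) / (α * β - β)) > Real.log ((α * β - 1) / (α - 1))) :
    β * (α - 1) < 1 := by
  have hαβ : 0 < α * β - 1 := by nlinarith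
  have hα1 : 0 < α - 1 := by linarith
  have hd : α * β - β = β * (α - 1) := by ring
  have hd0 : 0 < β * (α - 1) := by positivity
  rw [hd, gt_iff_lt, ← Nat.cast_ofNat, ← Real.log_pow,
    Real.log_lt_log_iff (by positivity) (by positivity), div_pow,
    div_lt_div_iff₀ hα1 (by positivity)] at h
  -- This rearranges to (β - 1)(β(α - 1) - 1) < 0.
  have h1 : β ^ 2 * (α - 1) < α * β - 1 := by
    have : (α * β - 1) * (α - 1) * (β ^ 2 * (α - 1)) < (α * β - 1) * (α - 1) * (α * β - 1) := by
      linarith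
    exact lt_of_mul_lt_mul_left this (by positivity)
  by_contra! hcon
  nlinarith [mul_nonneg (sub_nonneg.2 hcon) (sub_nonneg.2 hβ.le)]

theorem mul_sub_one_lt_one_of_sqrt {α β : ℝ} (hα : 1 ≤ α) (hα' : α < √(5 / 4))
    (hβ' : β < √(4 / 3)) : β * (α - 1) < 1 := by
  have h1 : √(5 / 4) ≤ 5 / 4 := Real.sqrt_le_iff.2 ⟨by norm_num, by norm_num⟩
  have h2 : √(4 / 3) ≤ 4 / 3 := Real.sqrt_le_iff.2 ⟨by norm_num, by norm_num⟩
  nlinarith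

theorem div_le_div_sub {x y z : ℝ} (hx : 0 ≤ x) (hy : 0 ≤ y) (hyz : y < z) :
    x / z ≤ x / (z - y) :=
  div_le_div_of_nonneg_left hx (by linarith) (by linarith)

theorem log_le_two_mul_sqrt {y : ℝ} (hy : 0 ≤ y) : Real.log y ≤ 2 * √y := by
  have := Real.log_le_self (Real.sqrt_nonneg y)
  rw [Real.log_sqrt hy] at this
  linarith

/-- From log n ≤ 2m^(1/4) and m^(1/4) ≥ 2C one gets C log n ≤ √m, while the other factor n is below
√m. -/
theorem mul_mul_log_le_of_lt_sqrt {C m : ℝ} (n : ℕ) (hC : 1 < C) (hm : 16 * C ^ 4 ≤ m)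
    (hn : n < √m) : C * (n * Real.log n) ≤ m := by
  have hm0 : 0 ≤ m := le_trans (by positivity) hm
  have hy : 4 * C ^ 2 ≤ √m := Real.le_sqrt_of_sq_le (by nlinarith)
  have hz : 2 * C ≤ √(√m) := Real.le_sqrt_of_sq_le (by nlinarith)
  have hn0 : 0 ≤ Real.log n := Real.log_natCast_nonneg n
  have h1 : Real.log n ≤ 2 * √(√m) := by
    rcases Nat.eq_zero_or_pos n with h0 | h0
    · simp [h0]
    · exact (Real.log_le_log (by exact_mod_cast h0) hn.le).trans
        (log_le_two_mul_sqrt (Real.sqrt_nonneg m))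
  have h2 : C * Real.log n ≤ √m := by
    nlinarith [Real.mul_self_sqrt (Real.sqrt_nonneg m), Real.sqrt_nonneg √m]
  calc C * (n * Real.log n) = n * (C * Real.log n) := by ring
    _ ≤ √m * √m := by gcongr
    _ = m := Real.mul_self_sqrt hm0

end FoodRescue

/-! ### The two donation models. -/

theorem mainTheorem1 :
    -- driver efficiency
    (∀ (V : Type u) [Fintype V] [PseudoMetricSpace V] (I : FoodRescue.Network V)
      (tie : ℕ → I.banks → I.banks → Bool), I.DriverEfficient 3 (I.twoChoice tie)) ∧
    -- envy-freeness for unit donations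
    (∀ α β : ℝ, 1 < α → 1 < β →
      2 * Real.log ((α * β - 1) / (α * β - β)) > Real.log ((α * β - 1) / (α - 1)) →
      ∀ k : ℝ, 0 < k → ∃ C : ℝ, 1 < C ∧
        ∀ (V : Type u) [Fintype V] [PseudoMetricSpace V] [MeasurableSpace V]
          [DiscreteMeasurableSpace V] (I : FoodRescue.Network V)
          (tie : ℕ → I.banks → I.banks → Bool) (D : Measure V) [IsProbabilityMeasure D],
          I.Biased α β D → ∀ m : ℕ, C * (I.total * Real.log I.total) ≤ m →
          1 - (I.total : ℝ) ^ (-k) ≤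
            (FoodRescue.loadLaw D (Measure.dirac (1 : ℝ≥0))).real
              {ω | I.EnvyFree
                (1 + C * ((I.total * Real.log I.total) / (m - I.total * Real.log I.total)))
                (I.transcript (I.twoChoice tie) ω m)}) ∧
    -- envy-freeness for random donation values
    (∀ α β : ℝ, 1 ≤ α → α < √(5 / 4) → 1 ≤ β → β < √(4 / 3) →
      ∀ (W : Measure ℝ≥0) [IsProbabilityMeasure W],
      (∃ l : ℝ, 0 < l ∧ Integrable (fun w : ℝ≥0 => Real.exp (l * w)) W) →
      ∫ w : ℝ≥0, (w : ℝ) ∂W = 1 →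
      ∀ k : ℝ, 0 < k → ∃ C : ℝ, 1 < C ∧
        ∀ (V : Type u) [Fintype V] [PseudoMetricSpace V] [MeasurableSpace V]
          [DiscreteMeasurableSpace V] (I : FoodRescue.Network V)
          (tie : ℕ → I.banks → I.banks → Bool) (D : Measure V) [IsProbabilityMeasure D],
          I.Biased α β D → ∀ m : ℕ, C ≤ m → I.total * √(m : ℝ) < m →
          1 - (I.total : ℝ) ^ (-k) ≤
            (FoodRescue.loadLaw D W).real
              {ω | I.EnvyFree
                (1 + C * ((I.total * Real.log I.total) / (m - I.total * √(m : ℝ))))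
                (I.transcript (I.twoChoice tie) ω m)}) := by
  refine ⟨fun V _ _ I tie => I.driverEfficient_twoChoice tie, ?_, ?_⟩
  · intro α β hα hβ hlog k hk
    obtain ⟨C, hC, h⟩ := FoodRescue.envyFree_core.{u} hα.le hβ.le
      (FoodRescue.mul_sub_one_lt_one_of_log hα hβ hlog) (Measure.dirac (1 : ℝ≥0)) one_pos
      (integrable_dirac (by simp)) (by simp) hk
    refine ⟨C, hC, fun V _ _ _ _ I tie D _ hD m hm => (h V I tie D hD m hm).trans ?_⟩
    have : IsProbabilityMeasure (FoodRescue.loadLaw D (Measure.dirac (1 : ℝ≥0))) := by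
      unfold FoodRescue.loadLaw
      infer_instance
    refine measureReal_mono fun ω hω => FoodRescue.Network.EnvyFree.mono I ?_ hω
    have hx : 0 ≤ (I.total : ℝ) * Real.log I.total :=
      mul_nonneg (Nat.cast_nonneg _) (Real.log_natCast_nonneg _)
    -- If N log N = 0 both error terms vanish; otherwise C > 1 makes m - N log N positive.
    rcases hx.eq_or_lt with h0 | h0
    · simp [← h0]
    · have := FoodRescue.div_le_div_sub hx hx (z := m) (by nlinarith)
      gcongr
  · intro α β hα hα' hβ hβ' W _ hW hW1 k hk
    obtain ⟨l, hl, hWl⟩ := hW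
    obtain ⟨C, hC, h⟩ := FoodRescue.envyFree_core.{u} hα hβ
      (FoodRescue.mul_sub_one_lt_one_of_sqrt hα hα' hβ') W hl hWl hW1 hk
    have hCC : C ≤ 16 * C ^ 4 := by
      have : C ≤ C ^ 4 := le_self_pow₀ hC.le (by norm_num)
      linarith
    refine ⟨16 * C ^ 4, by linarith, fun V _ _ _ _ I tie D _ hD m hm hNm => ?_⟩
    have hm0 : (0 : ℝ) ≤ m := Nat.cast_nonneg m
    have hN : (I.total : ℝ) < √(m : ℝ) := by
      refine lt_of_mul_lt_mul_right ?_ (Real.sqrt_nonneg m)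
      rwa [Real.mul_self_sqrt hm0]
    refine (h V I tie D hD m (FoodRescue.mul_mul_log_le_of_lt_sqrt _ hC hm hN)).trans ?_
    have : IsProbabilityMeasure (FoodRescue.loadLaw D W) := by
      unfold FoodRescue.loadLaw
      infer_instance
    refine measureReal_mono fun ω hω => FoodRescue.Network.EnvyFree.mono I ?_ hω
    have hx : 0 ≤ (I.total : ℝ) * Real.log I.total :=
      mul_nonneg (Nat.cast_nonneg _) (Real.log_natCast_nonneg _)
    have h1 := FoodRescue.div_le_div_sub hx (y := I.total * √(m : ℝ)) (by positivity) hNm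
    have h2 : 0 ≤ (I.total : ℝ) * Real.log I.total / m := div_nonneg hx hm0
    gcongr
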